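/- Let $k$ be an algebraically closed field, $N\cong\mathbb Z^r$ a lattice with dual $M=\operatorname{Hom}(N,\mathbb Z)$, and $\Delta$ a fan in $N$ (a finite collection of strongly convex rational polyhedral cones in $N_{\mathbb R}$, closed under taking faces, any two of which meet in a common face). Let $X=X(\Delta)$ be the associated toric variety over $k$, glued from the affine charts $U_\sigma=\operatorname{Spec}k[\sigma^\vee\cap M]$, $\sigma\in\Delta$, and assume that $X$ is proper over $k$. (Once $X$ carries an ample line bundle this is the same as $X$ being projective.) Let $\Delta(1)$ be the set of rays of $\Delta$, each identified with its primitive generator $v\in N$, and let $Y(v)\subset X$ be the torus-invariant prime divisor of $v$: it is the closure of the closed subset of $U_v$ defined by the ideal generated by the $x^u$, $u\in v^\vee\cap M$, with $\langle u,v\rangle>0$. Let $\operatorname{Cox}(X)=k[v : v\in\Delta(1)]$ be the polynomial ring with one variable for each ray, and let $$J_X=\Bigl(\prod_{v\in\Delta(1),\,v\notin\sigma}v \ :\ \sigma\in\Delta\Bigr)\subseteq \operatorname{Cox}(X)$$ be the irrelevant ideal. Let $D$ be any Weil divisor on $X$ such that $\mathcal O_X(D)$ is an ample line bundle, and write $$D=\sum_{v\in\Delta(1)}a_v\,Y(v)+\operatorname{div}(g)$$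 with $a_v\in\mathbb Z$ and $g\neq0$ a rational function on $X$ (every divisor can be written in this way). If $f\in H^0(X,\mathcal O_X(D))$, then $fg$ is a Laurent polynomial $\sum_u c_u x^u\in k[M]$, and $c_u\ne 0$ implies $\langle u,v\rangle+a_v\ge0$ for all $v\in\Delta(1)$. The image of $f$ in $\operatorname{Cox}(X)$ is defined to be $$\sum_u c_u\prod_{v\in\Delta(1)}v^{\langle u,v\rangle+a_v}.$$ Let $\bigl(H^0(X,D)\bigr)\subseteq\operatorname{Cox}(X)$ be the ideal generated by the images of all $f\in H^0(X,\mathcal O_X(D))$. Then $$J_X=\sqrt{\bigl(H^0(X,D)\bigr)} .$$ -/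

import Mathlib

universe u

namespace Toric

open CategoryTheory AlgebraicGeometry TensorProduct

section Lattice

variable {N : Type u} [AddCommGroup N]

/-- The image `1 ⊗ v` of a lattice vector `v ∈ N` in the real vector space `N_ℝ = ℝ ⊗ N`. -/
noncomputable def latticeVec (v : N) : ℝ ⊗[ℤ] N := 1 ⊗ₜ[ℤ] v

/-- The real pairing `⟨u, -⟩ : N_ℝ → ℝ` with an element `u` of the dual lattice
`M = Hom(N, ℤ)`. -/
noncomputable def pairing (u : Module.Dual ℤ N) : ℝ ⊗[ℤ] N →ₗ[ℝ] ℝ :=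
  (AlgebraTensorModule.rid ℤ ℝ ℝ).toLinearMap ∘ₗ LinearMap.baseChange ℝ u

@[simp] lemma pairing_latticeVec (u : Module.Dual ℤ N) (v : N) :
    pairing u (latticeVec v) = (u v : ℝ) := by
  simp [pairing, latticeVec]

lemma pairing_add (u v : Module.Dual ℤ N) (x : ℝ ⊗[ℤ] N) :
    pairing (u + v) x = pairing u x + pairing v x := by
  simp [pairing, LinearMap.baseChange_add]

lemma pairing_zero (x : ℝ ⊗[ℤ] N) : pairing (0 : Module.Dual ℤ N) x = 0 := by
  simp [pairing]

lemma pairing_neg (u : Module.Dual ℤ N) (x : ℝ ⊗[ℤ] N) : pairing (-u) x = - pairing u x := by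
  have h := pairing_add u (-u) x
  rw [add_neg_cancel, pairing_zero] at h
  linarith

/-- `τ` is a face of `σ`: the intersection of `σ` with a hyperplane `w = 0` such that `w ≥ 0` on
`σ` (with `w = 0` allowed, so that `σ` is a face of itself). -/
def IsFace (τ σ : PointedCone ℝ (ℝ ⊗[ℤ] N)) : Prop :=
  ∃ w : Module.Dual ℝ (ℝ ⊗[ℤ] N), (∀ x ∈ σ, 0 ≤ w x) ∧ ∀ x, x ∈ τ ↔ x ∈ σ ∧ w x = 0

/-- A rational polyhedral cone: the cone generated by finitely many lattice vectors. -/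
def IsRationalPolyhedral (σ : PointedCone ℝ (ℝ ⊗[ℤ] N)) : Prop :=
  ∃ s : Finset N, σ = PointedCone.hull ℝ (latticeVec '' (s : Set N))

/-- The monoid `σ^∨ ∩ M` of those `u ∈ M` that are nonnegative on the cone `σ`. -/
def dualMonoid (σ : PointedCone ℝ (ℝ ⊗[ℤ] N)) : AddSubmonoid (Module.Dual ℤ N) where
  carrier := {u | ∀ x ∈ σ, 0 ≤ pairing u x}
  add_mem' ha hb x hx := by rw [pairing_add]; exact add_nonneg (ha x hx) (hb x hx)
  zero_mem' x _ := by rw [pairing_zero]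

lemma mem_dualMonoid {σ : PointedCone ℝ (ℝ ⊗[ℤ] N)} {u : Module.Dual ℤ N} :
    u ∈ dualMonoid σ ↔ ∀ x ∈ σ, 0 ≤ pairing u x := Iff.rfl

lemma dualMonoid_anti {σ τ : PointedCone ℝ (ℝ ⊗[ℤ] N)} (h : τ ≤ σ) :
    dualMonoid σ ≤ dualMonoid τ := fun _ hu x hx => hu x (h hx)

lemma mem_dualMonoid_hull {s : Set N} {u : Module.Dual ℤ N} :
    u ∈ dualMonoid (PointedCone.hull ℝ (latticeVec '' s)) ↔ ∀ v ∈ s, 0 ≤ u v := by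
  constructor
  · intro h v hv
    have := h _ (Submodule.subset_span ⟨v, hv, rfl⟩)
    rw [pairing_latticeVec] at this
    exact_mod_cast this
  · intro h x hx
    induction hx using Submodule.span_induction with
    | mem x hx =>
      obtain ⟨v, hv, rfl⟩ := hx
      rw [pairing_latticeVec]
      exact_mod_cast h v hv
    | zero => simp
    | add x y _ _ hx hy => rw [map_add]; exact add_nonneg hx hy
    | smul c x _ hx =>
      have : pairing u (c • x) = (c : ℝ) * pairing u x := by
        rw [← smul_eq_mul, ← map_smul]; rfl
      rw [this]; exact mul_nonneg c.2 hx

/-- A real functional that is nonnegative on finitely many lattice vectors can be replaced by an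
integral one with the same zeros among them. -/
lemma exists_integral [Module.Finite ℤ N] (s : Finset N) (w : Module.Dual ℝ (ℝ ⊗[ℤ] N))
    (hw : ∀ v ∈ s, 0 ≤ w (latticeVec v)) :
    ∃ u : Module.Dual ℤ N, ∀ v ∈ s, 0 ≤ u v ∧ (u v = 0 ↔ w (latticeVec v) = 0) := by
  classical
  let φ : N →ₗ[ℤ] ℝ := (w.restrictScalars ℤ) ∘ₗ (TensorProduct.mk ℤ ℝ N 1)
  have hφ : ∀ v, φ v = w (latticeVec v) := fun v => rfl
  let G := LinearMap.range φ
  have : Module.Free ℤ G := Module.free_of_finite_type_torsion_free'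
  let b := Module.finBasis ℤ G
  let n := Module.finrank ℤ G
  let c : N → Fin n → ℤ := fun v i => b.repr (φ.rangeRestrict v) i
  have hsum : ∀ v, φ v = ∑ i, (c v i : ℝ) * (b i : ℝ) := by
    intro v
    have := congrArg (Subtype.val) (b.sum_repr (φ.rangeRestrict v))
    simp only [AddSubmonoidClass.coe_finsetSum, Submodule.coe_smul] at this
    rw [show φ v = ((φ.rangeRestrict v : G) : ℝ) from rfl, ← this]
    refine Finset.sum_congr rfl fun i _ => ?_
    simp [c]
  let U : Set (Fin n → ℝ) := {x | ∀ v ∈ s.filter (fun v => 0 < φ v), 0 < ∑ i, (c v i : ℝ) * x i}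
  have hU : IsOpen U := by
    have : U = ⋂ v ∈ s.filter (fun v => 0 < φ v), {x | 0 < ∑ i, (c v i : ℝ) * x i} := by
      ext x; simp [U]
    rw [this]
    refine isOpen_biInter_finset fun v _ => ?_
    exact isOpen_lt continuous_const (by fun_prop)
  have hne : U.Nonempty := ⟨fun i => (b i : ℝ), fun v hv => by
    rw [← hsum]; exact (Finset.mem_filter.mp hv).2⟩
  have hd : DenseRange (fun (q : Fin n → ℚ) (i : Fin n) => ((q i : ℚ) : ℝ)) :=
    DenseRange.piMap (fun _ => Rat.denseRange_cast)
  obtain ⟨q, hq⟩ := hd.exists_mem_open hU hne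
  let D : ℕ := ∏ i, (q i).den
  have hD : 0 < D := Finset.prod_pos fun i _ => (q i).den_pos
  have hm : ∀ i, ∃ m : ℤ, (m : ℚ) = D * q i := by
    intro i
    obtain ⟨e, he⟩ : (q i).den ∣ D := Finset.dvd_prod_of_mem _ (Finset.mem_univ i)
    refine ⟨e * (q i).num, ?_⟩
    rw [he]; push_cast
    have := Rat.den_mul_eq_num (q i)
    linear_combination (-(e : ℚ)) * this
  choose m hm using hm
  refine ⟨(b.constr ℤ m) ∘ₗ φ.rangeRestrict, fun v hv => ?_⟩
  have hu : (((b.constr ℤ m) (φ.rangeRestrict v) : ℤ) : ℝ) =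
      D * ∑ i, (c v i : ℝ) * ((q i : ℚ) : ℝ) := by
    rw [Module.Basis.constr_apply_fintype, Finset.mul_sum]
    push_cast
    refine Finset.sum_congr rfl fun i _ => ?_
    have : ((m i : ℤ) : ℝ) = D * ((q i : ℚ) : ℝ) := by exact_mod_cast congrArg (Rat.cast (K := ℝ)) (hm i)
    simp only [smul_eq_mul, Int.cast_mul]
    rw [this]
    simp only [c, Module.Basis.equivFun_apply]
    ring
  rcases (hw v hv).eq_or_lt with h0 | hpos
  · have : φ.rangeRestrict v = 0 := Subtype.ext (show φ v = 0 by rw [hφ, ← h0])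
    simp [this, ← h0]
  · have h1 := hq v (Finset.mem_filter.mpr ⟨hv, hpos⟩)
    have h2 : (0 : ℝ) < (((b.constr ℤ m) (φ.rangeRestrict v) : ℤ) : ℝ) := by
      rw [hu]; exact mul_pos (by exact_mod_cast hD) h1
    have h3 : 0 < (b.constr ℤ m) (φ.rangeRestrict v) := by exact_mod_cast h2
    exact ⟨h3.le, ⟨fun h => absurd h h3.ne', fun h => absurd h hpos.ne'⟩⟩

/-- A face of a rational polyhedral cone `σ` is cut out by an element of `σ^∨ ∩ M`. -/
lemma IsFace.exists_dual [Module.Finite ℤ N] {τ σ : PointedCone ℝ (ℝ ⊗[ℤ] N)} (h : IsFace τ σ)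
    (hσ : IsRationalPolyhedral σ) :
    ∃ u ∈ dualMonoid σ, ∀ x, x ∈ τ ↔ x ∈ σ ∧ pairing u x = 0 := by
  obtain ⟨s, rfl⟩ := hσ
  obtain ⟨w, hw, hτ⟩ := h
  obtain ⟨u, hu⟩ := exists_integral s w fun v hv => hw _ (Submodule.subset_span ⟨v, hv, rfl⟩)
  have hmem := mem_dualMonoid_hull.mpr fun v hv => (hu v hv).1
  refine ⟨u, hmem, fun x => ?_⟩
  rw [hτ]
  refine and_congr_right fun hx => ?_
  induction hx using Submodule.span_induction with
  | mem x hx =>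
    obtain ⟨v, hv, rfl⟩ := hx
    rw [pairing_latticeVec, ← (hu v hv).2]
    norm_cast
  | zero => simp
  | add x y hx hy ihx ihy =>
    rw [map_add, map_add, add_eq_zero_iff_of_nonneg (hw x hx) (hw y hy),
      add_eq_zero_iff_of_nonneg (hmem x hx) (hmem y hy), ihx, ihy]
  | smul c x _ ih =>
    have h1 : pairing u (c • x) = (c : ℝ) * pairing u x := by
      rw [← smul_eq_mul, ← map_smul]; rfl
    have h2 : w (c • x) = (c : ℝ) * w x := by
      rw [← smul_eq_mul, ← map_smul]; rfl
    rw [h1, h2, mul_eq_zero, mul_eq_zero, ih]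

/-- If `u` cuts out the face `τ` of `σ`, every element of `τ^∨ ∩ M` can be moved into
`σ^∨ ∩ M` by adding a multiple of `u`. -/
lemma exists_add_nsmul_mem {τ σ : PointedCone ℝ (ℝ ⊗[ℤ] N)} (hσ : IsRationalPolyhedral σ)
    {u : Module.Dual ℤ N} (hu : u ∈ dualMonoid σ) (hτ : ∀ x, x ∈ τ ↔ x ∈ σ ∧ pairing u x = 0)
    {m : Module.Dual ℤ N} (hm : m ∈ dualMonoid τ) : ∃ n : ℕ, m + n • u ∈ dualMonoid σ := by
  obtain ⟨s, rfl⟩ := hσ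
  refine ⟨∑ v ∈ s, (m v).natAbs, mem_dualMonoid_hull.mpr fun v hv => ?_⟩
  have h0 := mem_dualMonoid_hull.mp hu v hv
  have hle : (m v).natAbs ≤ ∑ v ∈ s, (m v).natAbs :=
    Finset.single_le_sum (f := fun v => (m v).natAbs) (fun _ _ => Nat.zero_le _) hv
  rcases h0.eq_or_lt with h | h
  · have hvτ : latticeVec v ∈ τ :=
      (hτ _).mpr ⟨Submodule.subset_span ⟨v, hv, rfl⟩, by rw [pairing_latticeVec, ← h]; simp⟩
    have := hm _ hvτ
    rw [pairing_latticeVec] at this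
    have h' : 0 ≤ m v := by exact_mod_cast this
    simp [← h, h']
  · simp only [LinearMap.add_apply, LinearMap.smul_apply, nsmul_eq_mul]
    have h1 : ((m v).natAbs : ℤ) ≤ ((∑ v ∈ s, (m v).natAbs : ℕ) : ℤ) := by exact_mod_cast hle
    have h2 : -(m v) ≤ ((m v).natAbs : ℤ) := by omega
    nlinarith

/-- Gordan's lemma. -/
lemma dualMonoid_fg [Module.Free ℤ N] [Module.Finite ℤ N] {σ : PointedCone ℝ (ℝ ⊗[ℤ] N)}
    (hσ : IsRationalPolyhedral σ) : (dualMonoid σ).FG := by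
  classical
  obtain ⟨s, rfl⟩ := hσ
  let L : Module.Dual ℤ N →ₗ[ℤ] (s → ℤ) := LinearMap.pi fun v => LinearMap.applyₗ (v : N)
  let ι : (s → ℕ) →+ (s → ℤ) := (Nat.castAddMonoidHom ℤ).compLeft s
  let P : AddSubmonoid (s → ℕ) := (LinearMap.range L).toAddSubmonoid.comap ι
  have hP : P.FG := by
    refine AddSubmonoid.fg_of_subtractive fun x hx y hxy => ?_
    have h1 : ι x ∈ LinearMap.range L := hx
    have h2 : ι (x + y) ∈ LinearMap.range L := hxy
    rw [map_add] at h2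
    exact (Submodule.add_mem_iff_right _ h1).mp h2
  obtain ⟨t, ht⟩ := hP
  have hker : (LinearMap.ker L).toAddSubmonoid.FG := by
    have h1 : (LinearMap.ker L).FG := IsNoetherian.noetherian _
    have h2 : (LinearMap.ker L).toAddSubgroup.FG := by
      rwa [← Submodule.fg_iff_addSubgroup_fg]
    exact (AddSubgroup.fg_iff_addSubmonoid_fg _).mp h2
  obtain ⟨t', ht'⟩ := hker
  have hlift : ∀ x : s → ℕ, x ∈ P → ∃ m : Module.Dual ℤ N, L m = ι x := fun x hx => hx
  choose! g hg using hlift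
  have htP : ∀ x ∈ t, x ∈ P := fun x hx => ht ▸ AddSubmonoid.subset_closure hx
  refine ⟨t.image g ∪ t', le_antisymm ?_ ?_⟩
  · rw [AddSubmonoid.closure_le]
    intro m hm
    rw [SetLike.mem_coe, mem_dualMonoid_hull]
    intro v hv
    simp only [Finset.coe_union, Finset.coe_image, Set.mem_union, Set.mem_image,
      Finset.mem_coe] at hm
    rcases hm with ⟨x, hx, rfl⟩ | hm
    · have := congrFun (hg x (htP x hx)) ⟨v, hv⟩
      change g x v = (x ⟨v, hv⟩ : ℤ) at this
      rw [this]; positivity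
    · have hm' : m ∈ (LinearMap.ker L).toAddSubmonoid := ht' ▸ AddSubmonoid.subset_closure hm
      have : L m = 0 := hm'
      have := congrFun this ⟨v, hv⟩
      change m v = 0 at this
      rw [this]
  · intro m hm
    rw [mem_dualMonoid_hull] at hm
    have key : ∀ x ∈ P, ∀ m, L m = ι x →
        m ∈ AddSubmonoid.closure ((t.image g ∪ t' : Finset _) : Set (Module.Dual ℤ N)) := by
      intro x hx
      rw [← ht] at hx
      have hkey0 : ∀ m, L m = 0 →
          m ∈ AddSubmonoid.closure ((t.image g ∪ t' : Finset _) : Set (Module.Dual ℤ N)) := by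
        intro m hm0
        have : m ∈ (LinearMap.ker L).toAddSubmonoid := hm0
        rw [← ht'] at this
        exact AddSubmonoid.closure_mono (by simp) this
      have hex : ∃ m ∈ AddSubmonoid.closure
          ((t.image g ∪ t' : Finset _) : Set (Module.Dual ℤ N)), L m = ι x := by
        induction hx using AddSubmonoid.closure_induction with
        | mem x hx => 
          refine ⟨g x, AddSubmonoid.subset_closure ?_, hg x (htP x hx)⟩
          simp only [Finset.coe_union, Finset.coe_image]
          exact Or.inl ⟨x, hx, rfl⟩
        | zero => exact ⟨0, zero_mem _, by simp⟩
        | add x y _ _ ihx ihy =>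
          obtain ⟨a, ha, hax⟩ := ihx
          obtain ⟨b, hb, hby⟩ := ihy
          exact ⟨a + b, add_mem ha hb, by rw [map_add, map_add, hax, hby]⟩
      intro m hmx
      obtain ⟨a, ha, hax⟩ := hex
      have := add_mem ha (hkey0 (m - a) (by rw [map_sub, hmx, hax, sub_self]))
      simpa using this
    have hx : L m = ι (fun v => (m v).toNat) := by
      funext v
      change m v = ((m v).toNat : ℤ)
      rw [Int.toNat_of_nonneg (hm v v.2)]
    exact key _ ⟨m, hx⟩ m hx

end Lattice

section Fan

variable (N : Type u) [AddCommGroup N]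

/-- A fan in the lattice `N`: a finite collection of rational polyhedral cones in `N_ℝ`, closed
under taking faces, any two of which meet along a common face. The zero cone belongs to the fan; by
`inter_face` it is then a face of every cone, i.e. all cones of the fan are strongly convex. -/
structure Fan where
  /-- the cones of the fan -/
  cones : Set (PointedCone ℝ (ℝ ⊗[ℤ] N))
  finite : cones.Finite
  zero_mem : ⊥ ∈ cones
  rational : ∀ σ ∈ cones, IsRationalPolyhedral σ
  face_mem : ∀ σ ∈ cones, ∀ τ, IsFace τ σ → τ ∈ cones
  inter_face : ∀ σ ∈ cones, ∀ τ ∈ cones, IsFace (σ ⊓ τ) σ ∧ IsFace (σ ⊓ τ) τ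

variable {N}

/-- The cones of a fan, partially ordered by inclusion. -/
abbrev Fan.Cone (Δ : Fan N) : Type u := {σ : PointedCone ℝ (ℝ ⊗[ℤ] N) // σ ∈ Δ.cones}

lemma Fan.isFace_of_le (Δ : Fan N) {τ σ : Δ.Cone} (h : τ ≤ σ) : IsFace τ.1 σ.1 := by
  have := (Δ.inter_face τ.1 τ.2 σ.1 σ.2).2
  rwa [inf_eq_left.mpr h] at this

end Fan

section Charts

variable (k : Type u) [Field k] {N : Type u} [AddCommGroup N]

/-- The coordinate ring `k[σ^∨ ∩ M]` of the affine toric variety `U_σ`. -/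
abbrev ChartRing (σ : PointedCone ℝ (ℝ ⊗[ℤ] N)) : Type u := AddMonoidAlgebra k (dualMonoid σ)

/-- The inclusion `k[σ^∨ ∩ M] → k[τ^∨ ∩ M]` for `τ ⊆ σ`. -/
noncomputable def chartMap {τ σ : PointedCone ℝ (ℝ ⊗[ℤ] N)} (h : τ ≤ σ) :
    ChartRing k σ →+* ChartRing k τ :=
  AddMonoidAlgebra.mapDomainRingHom k (AddSubmonoid.inclusion (dualMonoid_anti h))

lemma chartMap_single {τ σ : PointedCone ℝ (ℝ ⊗[ℤ] N)} (h : τ ≤ σ) (u : dualMonoid σ) (c : k) :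
    chartMap k h (.single u c) = .single (AddSubmonoid.inclusion (dualMonoid_anti h) u) c := by
  simp [chartMap]

lemma chartMap_injective {τ σ : PointedCone ℝ (ℝ ⊗[ℤ] N)} (h : τ ≤ σ) :
    Function.Injective (chartMap k h) :=
  AddMonoidAlgebra.mapDomain_injective (AddSubmonoid.inclusion_injective _)

lemma chartMap_isLocalization {τ σ : PointedCone ℝ (ℝ ⊗[ℤ] N)} (hσ : IsRationalPolyhedral σ)
    (h : τ ≤ σ) (u : dualMonoid σ) (hu : ∀ x, x ∈ τ ↔ x ∈ σ ∧ pairing u.1 x = 0) :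
    letI := (chartMap k h).toAlgebra
    IsLocalization.Away (.single u 1 : ChartRing k σ) (ChartRing k τ) := by
  let := (chartMap k h).toAlgebra
  have hneg : -u.1 ∈ dualMonoid τ := fun x hx => by
    rw [pairing_neg, ((hu x).mp hx).2, neg_zero]
  have hpow : ∀ n : ℕ, (.single u 1 : ChartRing k σ) ^ n = .single (n • u) 1 := fun n => by
    rw [AddMonoidAlgebra.single_pow, one_pow]
  refine IsLocalization.Away.mk _ ?_ ?_ ?_
  · refine IsUnit.of_mul_eq_one (.single ⟨-u.1, hneg⟩ 1) ?_
    change chartMap k h _ * _ = 1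
    rw [chartMap_single, AddMonoidAlgebra.single_mul_single, AddMonoidAlgebra.one_def]
    congr 1
    · ext1; simp
    · simp
  · intro s
    change ∃ n a, s * (chartMap k h _) ^ n = chartMap k h a
    induction s using AddMonoidAlgebra.induction_on with
    | of m =>
      obtain ⟨n, hn⟩ := exists_add_nsmul_mem hσ u.2 hu m.2
      refine ⟨n, .single ⟨_, hn⟩ 1, ?_⟩
      rw [← map_pow, hpow, chartMap_single, chartMap_single]
      simp only [AddMonoidAlgebra.of_apply, AddMonoidAlgebra.single_mul_single, mul_one]
      congr 1
    | add x y hx hy =>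
      obtain ⟨n, a, ha⟩ := hx
      obtain ⟨m, b, hb⟩ := hy
      refine ⟨n + m, a * (.single u 1) ^ m + b * (.single u 1) ^ n, ?_⟩
      rw [map_add, map_mul, map_mul, ← ha, ← hb, map_pow, map_pow]
      ring
    | smul r x hx =>
      obtain ⟨n, a, ha⟩ := hx
      refine ⟨n, .single 0 r * a, ?_⟩
      have hr : chartMap k h (.single 0 r) = algebraMap k _ r := by
        rw [chartMap_single, map_zero]; rfl
      rw [map_mul, ← ha, hr, smul_mul_assoc, Algebra.smul_def]
  · intro a b hab
    exact ⟨0, by rw [chartMap_injective k h hab]⟩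

end Charts

section Scheme

variable (k : Type u) [Field k] {N : Type u} [AddCommGroup N] (Δ : Fan N)

/-- The diagram `σ ↦ U_σ = Spec k[σ^∨ ∩ M]` of affine charts, indexed by the cones of the fan. -/
noncomputable def chartDiagram : Δ.Cone ⥤ Scheme.{u} where
  obj σ := Spec (.of (ChartRing k σ.1))
  map f := Spec.map (CommRingCat.ofHom (chartMap k (leOfHom f)))
  map_id σ := by
    rw [← Spec.map_id]
    congr 1
    exact congrArg CommRingCat.ofHom
      (AddMonoidAlgebra.mapDomainRingHom_id (R := k) (M := dualMonoid σ.1))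
  map_comp {ρ τ σ} f g := by
    rw [← Spec.map_comp, ← CommRingCat.ofHom_comp]
    congr 2
    exact AddMonoidAlgebra.mapDomainRingHom_comp (R := k)
      (AddSubmonoid.inclusion (dualMonoid_anti (leOfHom f)))
      (AddSubmonoid.inclusion (dualMonoid_anti (leOfHom g)))

lemma chartDiagram_range {τ σ : Δ.Cone} (f : τ ⟶ σ) (u : dualMonoid σ.1)
    (hu : ∀ x, x ∈ τ.1 ↔ x ∈ σ.1 ∧ pairing u.1 x = 0) :
    Set.range ((chartDiagram k Δ).map f) =
      (PrimeSpectrum.basicOpen (.single u 1 : ChartRing k σ.1) : Set (PrimeSpectrum _)) := by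
  let := (chartMap k (leOfHom f)).toAlgebra
  have := chartMap_isLocalization k (Δ.rational _ σ.2) (leOfHom f) u hu
  exact PrimeSpectrum.localization_away_comap_range _ _

lemma uniqueSums_dualMonoid (σ : PointedCone ℝ (ℝ ⊗[ℤ] N)) : UniqueSums (dualMonoid σ) :=
  UniqueSums.of_injective_addHom
    ({ toFun := fun u v => u.1 v, map_add' := fun _ _ => rfl } : dualMonoid σ →ₙ+ (N → ℤ))
    (fun _ _ h => Subtype.ext (LinearMap.ext fun v => congrFun h v)) inferInstance

instance chartRing_isDomain (σ : PointedCone ℝ (ℝ ⊗[ℤ] N)) : IsDomain (ChartRing k σ) := by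
  have := uniqueSums_dualMonoid σ
  have : NoZeroDivisors (ChartRing k σ) := inferInstance
  exact NoZeroDivisors.to_isDomain _

variable [Module.Finite ℤ N]

instance chartDiagram_isOpenImmersion {τ σ : Δ.Cone} (f : τ ⟶ σ) :
    IsOpenImmersion ((chartDiagram k Δ).map f) := by
  obtain ⟨u, hu, hτ⟩ := (Δ.isFace_of_le (leOfHom f)).exists_dual (Δ.rational _ σ.2)
  let := (chartMap k (leOfHom f)).toAlgebra
  have := chartMap_isLocalization k (Δ.rational _ σ.2) (leOfHom f) ⟨u, hu⟩ hτ
  exact IsOpenImmersion.of_isLocalization (.single ⟨u, hu⟩ 1 : ChartRing k σ.1)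

instance chartDiagram_isLocallyDirected :
    (chartDiagram k Δ ⋙ Scheme.forget).IsLocallyDirected where
  cond {i j σ} fi fj xi xj h := by
    obtain ⟨u, hu, hi⟩ := (Δ.isFace_of_le (leOfHom fi)).exists_dual (Δ.rational _ σ.2)
    obtain ⟨v, hv, hj⟩ := (Δ.isFace_of_le (leOfHom fj)).exists_dual (Δ.rational _ σ.2)
    let l : Δ.Cone := ⟨i.1 ⊓ j.1, Δ.face_mem _ i.2 _ (Δ.inter_face _ i.2 _ j.2).1⟩
    have hli : l ≤ i := inf_le_left (a := i.1) (b := j.1)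
    have hlj : l ≤ j := inf_le_right (a := i.1) (b := j.1)
    have hl : ∀ x, x ∈ l.1 ↔ x ∈ σ.1 ∧ pairing (u + v) x = 0 := by
      intro x
      rw [pairing_add]
      change x ∈ i.1 ⊓ j.1 ↔ _
      rw [Submodule.mem_inf, hi, hj]
      constructor
      · rintro ⟨⟨h1, h2⟩, -, h3⟩
        exact ⟨h1, by rw [h2, h3, add_zero]⟩
      · rintro ⟨h1, h2⟩
        have := (add_eq_zero_iff_of_nonneg (hu x h1) (hv x h1)).mp h2
        exact ⟨⟨h1, this.1⟩, h1, this.2⟩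
    have hmi := chartDiagram_range k Δ fi ⟨u, hu⟩ hi
    have hmj := chartDiagram_range k Δ fj ⟨v, hv⟩ hj
    have hml := chartDiagram_range k Δ (homOfLE hli ≫ fi) ⟨u + v, add_mem hu hv⟩ hl
    have h' : (chartDiagram k Δ).map fi xi = (chartDiagram k Δ).map fj xj := h
    have hx : (chartDiagram k Δ).map fi xi ∈
        Set.range ((chartDiagram k Δ).map (homOfLE hli ≫ fi)) := by
      have h1 : (chartDiagram k Δ).map fi xi ∈ Set.range ((chartDiagram k Δ).map fi) := ⟨_, rfl⟩
      have h2 : (chartDiagram k Δ).map fi xi ∈ Set.range ((chartDiagram k Δ).map fj) :=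
        ⟨_, h'.symm⟩
      rw [hmi] at h1
      rw [hmj] at h2
      rw [hml]
      have : (.single ⟨u + v, add_mem hu hv⟩ 1 : ChartRing k σ.1) =
          .single ⟨u, hu⟩ 1 * .single ⟨v, hv⟩ 1 := by
        rw [AddMonoidAlgebra.single_mul_single, mul_one]; rfl
      rw [this, PrimeSpectrum.basicOpen_mul]
      exact ⟨h1, h2⟩
    obtain ⟨x, hx⟩ := hx
    refine ⟨l, homOfLE hli, homOfLE hlj, x, ?_, ?_⟩
    · apply ((chartDiagram k Δ).map fi).isOpenEmbedding.injective
      rw [← hx, Functor.map_comp]; rfl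
    · apply ((chartDiagram k Δ).map fj).isOpenEmbedding.injective
      rw [← h', ← hx, show homOfLE hli ≫ fi = homOfLE hlj ≫ fj from Subsingleton.elim _ _,
        Functor.map_comp]; rfl

/-- The toric variety `X(Δ)` over `k`: the scheme obtained by gluing the affine charts
`U_σ = Spec k[σ^∨ ∩ M]`, `σ ∈ Δ`, along the open subschemes `U_τ ⊆ U_σ` for `τ ⊆ σ`. -/
noncomputable def toricVariety : Scheme.{u} := Limits.colimit (chartDiagram k Δ)

/-- The inclusion of the affine chart `U_σ` into `X(Δ)`. -/
noncomputable def chart (σ : Δ.Cone) : Spec (.of (ChartRing k σ.1)) ⟶ toricVariety k Δ :=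
  Limits.colimit.ι (chartDiagram k Δ) σ

instance chart_isOpenImmersion (σ : Δ.Cone) : IsOpenImmersion (chart k Δ σ) :=
  inferInstanceAs (IsOpenImmersion (Limits.colimit.ι (chartDiagram k Δ) σ))

lemma chartDiagram_map_chart {τ σ : Δ.Cone} (f : τ ⟶ σ) :
    (chartDiagram k Δ).map f ≫ chart k Δ σ = chart k Δ τ :=
  Limits.colimit.w (chartDiagram k Δ) f

lemma exists_chart (x : toricVariety k Δ) : ∃ σ y, chart k Δ σ y = x :=
  Scheme.IsLocallyDirected.ι_jointly_surjective (chartDiagram k Δ) x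

/-- The structure morphism `X(Δ) → Spec k`. -/
noncomputable def toricVarietyToSpec : toricVariety k Δ ⟶ Spec (.of k) :=
  Limits.colimit.desc (chartDiagram k Δ)
    { pt := Spec (.of k)
      ι :=
        { app σ := Spec.map (CommRingCat.ofHom (algebraMap k (ChartRing k σ.1)))
          naturality τ σ f := by
            change Spec.map _ ≫ Spec.map _ = Spec.map _ ≫ 𝟙 _
            rw [Category.comp_id, ← Spec.map_comp, ← CommRingCat.ofHom_comp]
            congr 2
            refine RingHom.ext fun r => ?_
            change chartMap k (leOfHom f) (.single 0 r) = .single 0 r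
            rw [chartMap_single, map_zero] } }

/-- The cone `{0}` of the fan. -/
def Fan.zeroCone (Δ : Fan N) : Δ.Cone := ⟨⊥, Δ.zero_mem⟩

instance toricVariety_isIntegral : AlgebraicGeometry.IsIntegral (toricVariety k Δ) := by
  have hred : AlgebraicGeometry.IsReduced (toricVariety k Δ) := by
    apply +allowSynthFailures isReduced_of_isReduced_stalk
    intro x
    obtain ⟨σ, y, rfl⟩ := exists_chart k Δ x
    exact isReduced_of_injective ((chart k Δ σ).stalkMap y).hom
      (ConcreteCategory.bijective_of_isIso ((chart k Δ σ).stalkMap y)).1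
  have hirr : IrreducibleSpace (toricVariety k Δ) := by
    have h0 : IsIrreducible (Set.range (chart k Δ Δ.zeroCone)) := by
      rw [← Set.image_univ]
      exact (IrreducibleSpace.isIrreducible_univ _).image _
        (chart k Δ Δ.zeroCone).continuous.continuousOn
    have hd : closure (Set.range (chart k Δ Δ.zeroCone)) = Set.univ := by
      refine Set.eq_univ_of_forall fun x => ?_
      obtain ⟨σ, y, rfl⟩ := exists_chart k Δ x
      have hle : Δ.zeroCone ≤ σ := bot_le (a := σ.1)
      rw [← chartDiagram_map_chart k Δ (homOfLE hle)]
      have hy : y ∈ closure (Set.range ((chartDiagram k Δ).map (homOfLE hle))) := by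
        have hop := ((chartDiagram k Δ).map (homOfLE hle)).isOpenEmbedding.isOpen_range
        have : IrreducibleSpace ((chartDiagram k Δ).obj σ) :=
          inferInstanceAs (IrreducibleSpace (Spec (.of (ChartRing k σ.1))))
        have : Nonempty ((chartDiagram k Δ).obj Δ.zeroCone) :=
          inferInstanceAs (Nonempty (Spec (.of (ChartRing k Δ.zeroCone.1))))
        exact hop.dense (Set.range_nonempty _) y
      refine closure_mono ?_ (image_closure_subset_closure_image
        (chart k Δ σ).continuous ⟨y, hy, rfl⟩)
      rintro _ ⟨_, ⟨z, rfl⟩, rfl⟩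
      exact ⟨z, rfl⟩
    rw [irreducibleSpace_def, Set.top_eq_univ, ← hd]
    exact h0.closure
  exact isIntegral_of_irreducibleSpace_of_isReduced _

instance toricVariety_isLocallyNoetherian [Module.Free ℤ N] :
    IsLocallyNoetherian (toricVariety k Δ) := by
  refine (isLocallyNoetherian_iff_openCover
    (Scheme.IsLocallyDirected.openCover (chartDiagram k Δ))).mpr fun σ => ?_
  have h1 : (dualMonoid σ.1).FG := dualMonoid_fg (Δ.rational _ σ.2)
  have : AddMonoid.FG (dualMonoid σ.1) := (AddMonoid.fg_iff_addSubmonoid_fg _).mpr h1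
  have : IsNoetherianRing (ChartRing k σ.1) := Algebra.FiniteType.isNoetherianRing k _
  change IsLocallyNoetherian (Spec (.of (ChartRing k σ.1)))
  infer_instance

end Scheme

section Rays

variable {N : Type u} [AddCommGroup N]

/-- A primitive lattice vector: one that is not a multiple of a lattice vector by a non-unit. -/
def IsPrimitiveVec (v : N) : Prop := ∀ (n : ℤ) (w : N), v = n • w → IsUnit n

lemma IsPrimitiveVec.exists_dual [Module.Free ℤ N] [Module.Finite ℤ N] {v : N}
    (hv : IsPrimitiveVec v) : ∃ u : Module.Dual ℤ N, u v = 1 := by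
  let b := Module.finBasis ℤ N
  let I : Ideal ℤ := LinearMap.range (LinearMap.applyₗ (R := ℤ) (M₂ := ℤ) v)
  obtain ⟨n, hn⟩ := (IsPrincipalIdealRing.principal I).principal
  have hc : ∀ i, ∃ c : ℤ, c * n = b.coord i v := by
    intro i
    have : b.coord i v ∈ I := ⟨b.coord i, rfl⟩
    rw [hn] at this
    exact Submodule.mem_span_singleton.mp this
  choose c hc using hc
  have hu : IsUnit n := by
    refine hv n (∑ i, c i • b i) ?_
    rw [Finset.smul_sum]
    conv_lhs => rw [← b.sum_repr v]
    refine Finset.sum_congr rfl fun i _ => ?_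
    rw [smul_smul, mul_comm n, hc]; rfl
  have h1 : (1 : ℤ) ∈ I := by
    have hI : I = ⊤ := by
      rw [hn]; exact Ideal.span_singleton_eq_top.mpr hu
    rw [hI]; trivial
  exact h1

/-- The set `Δ(1)` of rays of the fan; a ray is identified with its primitive generator. -/
abbrev Fan.Ray (Δ : Fan N) : Type u :=
  {v : N // IsPrimitiveVec v ∧ PointedCone.hull ℝ {latticeVec v} ∈ Δ.cones}

/-- The ray as a cone of the fan. -/
noncomputable def Fan.rayCone (Δ : Fan N) (v : Δ.Ray) : Δ.Cone :=
  ⟨PointedCone.hull ℝ {latticeVec v.1}, v.2.2⟩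

lemma hull_injective_of_isPrimitiveVec [Module.Free ℤ N] [Module.Finite ℤ N] {v w : N}
    (hv : IsPrimitiveVec v) (hw : IsPrimitiveVec w)
    (h : PointedCone.hull ℝ {latticeVec v} = PointedCone.hull ℝ {latticeVec w}) : v = w := by
  have key : ∀ {v w : N}, PointedCone.hull ℝ {latticeVec v} = PointedCone.hull ℝ {latticeVec w} →
      ∃ c : ℝ, 0 ≤ c ∧ ∀ u : Module.Dual ℤ N, c * u w = u v := by
    intro v w h
    have : latticeVec v ∈ PointedCone.hull ℝ {latticeVec w} := h ▸ Submodule.mem_span_singleton_self _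
    obtain ⟨c, hc⟩ := Submodule.mem_span_singleton.mp this
    refine ⟨c, c.2, fun u => ?_⟩
    rw [← pairing_latticeVec u v, ← hc, ← pairing_latticeVec u w]
    change _ = pairing u ((c : ℝ) • latticeVec w)
    rw [map_smul, smul_eq_mul]
  obtain ⟨c, hc0, hc⟩ := key h
  obtain ⟨d, hd0, hd⟩ := key h.symm
  obtain ⟨u, hu⟩ := hv.exists_dual
  obtain ⟨t, ht⟩ := hw.exists_dual
  have h1 : c = (t v : ℝ) := by rw [← hc t, ht]; simp
  have h2 : d = (u w : ℝ) := by rw [← hd u, hu]; simp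
  have h3 : c * d = 1 := by
    rw [h2, hc u, hu]; simp
  have h4 : c = 1 := by
    rw [h1, h2] at h3
    have h3' : t v * u w = 1 := by exact_mod_cast h3
    have h5 : 0 ≤ t v := by rw [h1] at hc0; exact_mod_cast hc0
    rw [h1]
    rcases Int.eq_one_or_neg_one_of_mul_eq_one h3' with h | h
    · rw [h]; simp
    · omega
  have h6 : ∀ u : Module.Dual ℤ N, u (v - w) = 0 := by
    intro u
    have := hc u
    rw [h4, one_mul] at this
    have : u w = u v := by exact_mod_cast this
    rw [map_sub, this, sub_self]
  exact sub_eq_zero.mp ((Module.forall_dual_apply_eq_zero_iff ℤ _).mp h6)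

instance Fan.finite_ray [Module.Free ℤ N] [Module.Finite ℤ N] (Δ : Fan N) : Finite Δ.Ray := by
  have : Finite Δ.Cone := Δ.finite.to_subtype
  refine Finite.of_injective Δ.rayCone fun v w h => Subtype.ext ?_
  exact hull_injective_of_isPrimitiveVec v.2.1 w.2.1 (congrArg Subtype.val h)

noncomputable instance Fan.fintype_ray [Module.Free ℤ N] [Module.Finite ℤ N] (Δ : Fan N) :
    Fintype Δ.Ray := Fintype.ofFinite _

variable (k : Type u) [Field k] (Δ : Fan N)

/-- The ideal of the divisor `Y(v)` in `U_v = Spec k[v^∨ ∩ M]`, generated by the characters `x^u`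
with `⟨u, v⟩ > 0`. -/
noncomputable def rayIdeal (v : Δ.Ray) : Ideal (ChartRing k (Δ.rayCone v).1) :=
  Ideal.span {x | ∃ u : dualMonoid (Δ.rayCone v).1, 0 < u.1 v.1 ∧ x = .single u 1}

lemma nonneg_of_mem_rayCone (v : Δ.Ray) (u : dualMonoid (Δ.rayCone v).1) : 0 ≤ u.1 v.1 := by
  have := u.2 _ (Submodule.mem_span_singleton_self _)
  rw [pairing_latticeVec] at this
  exact_mod_cast this

instance rayIdeal_isPrime (v : Δ.Ray) : (rayIdeal k Δ v).IsPrime := by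
  classical
  let R := ChartRing k (Δ.rayCone v).1
  let e : Multiplicative (dualMonoid (Δ.rayCone v).1) →* R :=
    { toFun := fun u => if u.toAdd.1 v.1 = 0 then .single u.toAdd 1 else 0
      map_one' := by simp; rfl
      map_mul' := fun x y => by
        have hx := nonneg_of_mem_rayCone Δ v x.toAdd
        have hy := nonneg_of_mem_rayCone Δ v y.toAdd
        by_cases h1 : x.toAdd.1 v.1 = 0
        · by_cases h2 : y.toAdd.1 v.1 = 0
          · simp only [toAdd_mul, AddSubmonoid.coe_add, LinearMap.add_apply, h1, h2, add_zero,
              if_true]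
            rw [AddMonoidAlgebra.single_mul_single, mul_one]
          · simp [h1, h2]
        · have : x.toAdd.1 v.1 + y.toAdd.1 v.1 ≠ 0 := by omega
          simp [h1, this] }
  let E : R →ₐ[k] R := AddMonoidAlgebra.lift k R _ e
  have hE : ∀ u c, E (.single u c) = if u.1 v.1 = 0 then .single u c else 0 := by
    intro u c
    have : E (.single u c) = c • e (Multiplicative.ofAdd u) := AddMonoidAlgebra.lift_single _ _ _
    rw [this]
    change c • (if u.1 v.1 = 0 then (.single u 1 : R) else 0) = _
    split_ifs
    · rw [AddMonoidAlgebra.smul_single, smul_eq_mul, mul_one]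
    · rw [smul_zero]
  have hsub : ∀ x : R, x - E x ∈ rayIdeal k Δ v := by
    intro x
    induction x using AddMonoidAlgebra.induction_on with
    | of u =>
      rw [AddMonoidAlgebra.of_apply, hE]
      split_ifs with h
      · rw [sub_self]; exact zero_mem _
      · rw [sub_zero]
        refine Ideal.subset_span ⟨_, ?_, rfl⟩
        exact lt_of_le_of_ne (nonneg_of_mem_rayCone Δ v _) (Ne.symm h)
    | add x y hx hy =>
      rw [map_add, add_sub_add_comm]; exact add_mem hx hy
    | smul r x hx =>
      rw [map_smul, ← smul_sub]
      rw [Algebra.smul_def]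
      exact Ideal.mul_mem_left _ _ hx
  have : rayIdeal k Δ v = RingHom.ker E.toRingHom := by
    refine le_antisymm (Ideal.span_le.mpr ?_) fun x hx => ?_
    · rintro _ ⟨u, hu, rfl⟩
      change E _ = 0
      rw [hE, if_neg hu.ne']
    · have h0 : E x = 0 := hx
      have := hsub x
      rwa [h0, sub_zero] at this
  rw [this]
  exact RingHom.ker_isPrime _

end Rays

section Divisors

variable {X : Scheme.{u}} [AlgebraicGeometry.IsIntegral X] [IsLocallyNoetherian X]

/-- The sections over `U` of the sheaf `O_X(D)` associated to a Weil divisor `D`: the rational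
functions `f` with `f = 0` or `div f + D ≥ 0` on `U`. Only the coefficients of `D` at points of
codimension one are used. -/
def divisorSections (D : AlgebraicCycle X ℤ) (U : X.Opens) : Set X.functionField :=
  {f | f = 0 ∨ ∀ z ∈ U, Order.coheight z = 1 → 0 ≤ Scheme.ord f z + D z}

/-- The rational function `g` generates `O_X(D)` on a neighbourhood of `x`, i.e. `O_X(D)` agrees
with `g O_X` as a subsheaf of the sheaf of rational functions there. -/
def GeneratesAt (D : AlgebraicCycle X ℤ) (x : X) (g : X.functionField) : Prop :=
  ∃ U : X.Opens, x ∈ U ∧ ∀ V ≤ U, ∀ f : X.functionField,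
    f ∈ divisorSections D V ↔
      ∀ y ∈ V, ∃ r : X.presheaf.stalk y, f = algebraMap (X.presheaf.stalk y) X.functionField r * g

/-- `D` is ample: `X` is quasi-compact, `O_X(D)` is a line bundle, and every point `x` lies in an
affine open set of the form `X_s = {y | s generates O_X(nD) at y}` with `n ≥ 1` and `s` a global
section of `O_X(nD) = O_X(D)^{⊗ n}`. -/
structure IsAmple (D : AlgebraicCycle X ℤ) : Prop where
  compactSpace : CompactSpace X
  isLineBundle : ∀ x : X, ∃ g : X.functionField, GeneratesAt D x g
  exists_affine : ∀ x : X, ∃ n : ℕ, 0 < n ∧ ∃ s ∈ divisorSections (n • D) ⊤,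
    ∃ U : X.Opens, IsAffineOpen U ∧ x ∈ U ∧ ∀ y, y ∈ U ↔ GeneratesAt (n • D) y s

end Divisors

section Cox

variable (k : Type u) [Field k] {N : Type u} [AddCommGroup N] [Module.Free ℤ N]
  [Module.Finite ℤ N] (Δ : Fan N)

/-- The generic point of the torus-invariant prime divisor `Y(v)` of `X(Δ)`. -/
noncomputable def divisorPoint (v : Δ.Ray) : toricVariety k Δ :=
  chart k Δ (Δ.rayCone v) (⟨rayIdeal k Δ v, inferInstance⟩ : PrimeSpectrum _)

open Classical in
/-- The torus-invariant Weil divisor `∑ a_v Y(v)` on `X(Δ)`. -/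
noncomputable def toricDivisor (a : Δ.Ray → ℤ) : AlgebraicCycle (toricVariety k Δ) ℤ :=
  ∑ v, Function.locallyFinsuppWithin.single (divisorPoint k Δ v) (a v)

/-- The Cox ring of `X(Δ)`: the polynomial ring on the rays of the fan. -/
abbrev CoxRing : Type u := MvPolynomial Δ.Ray k

open Classical in
/-- The irrelevant ideal `J_X`, generated by the monomials `v^{σ̄} = ∏_{v ∉ σ} v`, `σ ∈ Δ`. -/
noncomputable def irrelevantIdeal : Ideal (CoxRing k Δ) :=
  Ideal.span (Set.range fun σ : Δ.Cone =>
    ∏ v with latticeVec v.1 ∉ σ.1, (MvPolynomial.X v : CoxRing k Δ))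

instance chart_image_nonempty (σ : Δ.Cone) : Nonempty ↥(chart k Δ σ ''ᵁ ⊤) := by
  obtain ⟨y⟩ : Nonempty (Spec (.of (ChartRing k σ.1))) := inferInstance
  exact ⟨⟨_, y, trivial, rfl⟩⟩

/-- Regular functions on the chart `U_σ`, as rational functions on `X(Δ)`. For `σ = {0}` this is
the map from the Laurent polynomial ring `k[M]` to the function field of `X(Δ)`. -/
noncomputable def chartToFunctionField (σ : Δ.Cone) :
    ChartRing k σ.1 →+* (toricVariety k Δ).functionField :=
  haveI : Nonempty (chart k Δ σ ''ᵁ ⊤) := chart_image_nonempty k Δ σ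
  (((Scheme.ΓSpecIso (.of (ChartRing k σ.1))).inv ≫ ((chart k Δ σ).appIso ⊤).inv) ≫
    (toricVariety k Δ).germToFunctionField (chart k Δ σ ''ᵁ ⊤)).hom

/-- Homogenization with respect to `∑ a_v Y(v)`: the `k`-linear map from `k[M]` to the Cox ring
sending a character `x^u` with `⟨u, v⟩ + a_v ≥ 0` for all rays `v` to `∏ v^(⟨u, v⟩ + a_v)`.
(It is only used on combinations of such characters.) -/
noncomputable def homogenize (a : Δ.Ray → ℤ) (p : ChartRing k Δ.zeroCone.1) : CoxRing k Δ :=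
  p.coeff.sum fun u c =>
    MvPolynomial.monomial (Finsupp.equivFunOnFinite.symm fun v => (u.1 v.1 + a v).toNat) c

/-- The ideal of the Cox ring generated by the images of the global sections of `O_X(D)`, where
`D = ∑ a_v Y(v) + div g`: a section `f` of `O_X(D)` gives the section `f g` of
`O_X(∑ a_v Y(v))`, which is a Laurent polynomial and is then homogenized. -/
noncomputable def sectionIdeal (D : AlgebraicCycle (toricVariety k Δ) ℤ) (a : Δ.Ray → ℤ)
    (g : (toricVariety k Δ).functionField) : Ideal (CoxRing k Δ) :=
  Ideal.span {F | ∃ f ∈ divisorSections D ⊤, ∃ p : ChartRing k Δ.zeroCone.1,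
    chartToFunctionField k Δ Δ.zeroCone p = f * g ∧ F = homogenize k Δ a p}

end Cox

end Toric

/-!
Write `D` for `∑ a_v Y(v)` and `P_D` for the set of `u ∈ M` with `⟨u, v⟩ + a_v ≥ 0` for all `v`.
Then `H⁰(X, D)` is spanned by the characters `x^u`, `u ∈ P_D`, and `x^u` homogenizes to the monomial
with exponents `⟨u, v⟩ + a_v`.

Ampleness gives two facts about each cone `σ`, both read off at a point of `U_σ` where all `Y(v)`
with `v ∈ σ` meet. A local generator of `O(D)` yields `u_σ ∈ M` with `⟨u_σ, v⟩ = -a_v` for `v ∈ σ`.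
A section of a multiple `nD` that does not vanish at the point but vanishes on all `Y(v)` with
`v ∉ σ` contains a monomial with the same two properties. Thus the piecewise linear function of `D`
is integral and strictly convex.

Properness makes `Δ` complete: by the valuative criterion every monomial valuation of `k[M]`, with
values in any ordered group, is centred on some `U_σ`. Given `u ∈ P_D`, the sum of the `v` with
`⟨u, v⟩ + a_v = 0` lies in some cone `σ`, and strict convexity puts each of these `v` into `σ`;
hence the monomial of `u` lies in `J_X`, which is radical. For the other inclusion every `σ` needs
a `u ∈ P_D` with `⟨u, v⟩ = -a_v` for `v ∈ σ`, since some power of `∏_{v ∉ σ} v` is then divisible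
by the monomial of `u`. A lexicographic perturbation of the sum of the rays of `σ` selects a
full-dimensional cone `σ'`, which contains these rays by strict convexity, and `u = u_σ'` works:
being determined by its values on `σ'`, it agrees up to a multiple with the monomial of `nD` above.
-/

namespace Toric

open CategoryTheory AlgebraicGeometry TensorProduct

section RationalCones

variable {N : Type u} [AddCommGroup N] {σ : PointedCone ℝ (ℝ ⊗[ℤ] N)}

lemma latticeVec_zero : latticeVec (0 : N) = 0 := TensorProduct.tmul_zero _ _

lemma latticeVec_zsmul (d : ℤ) (v : N) : latticeVec (d • v) = (d : ℝ) • latticeVec v := by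
  rw [latticeVec, latticeVec, TensorProduct.tmul_smul, Int.cast_smul_eq_zsmul]

lemma nonneg_of_mem_dualMonoid {u : Module.Dual ℤ N} (hu : u ∈ dualMonoid σ) {v : N}
    (hv : latticeVec v ∈ σ) : 0 ≤ u v := by
  have := hu _ hv
  rw [pairing_latticeVec] at this
  exact_mod_cast this

lemma IsRationalPolyhedral.mem_dualMonoid_iff (hσ : IsRationalPolyhedral σ)
    {u : Module.Dual ℤ N} : u ∈ dualMonoid σ ↔ ∀ v : N, latticeVec v ∈ σ → 0 ≤ u v := by
  refine ⟨fun hu v hv => nonneg_of_mem_dualMonoid hu hv, fun h => ?_⟩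
  obtain ⟨s, rfl⟩ := hσ
  exact mem_dualMonoid_hull.mpr fun v hv => h v (Submodule.subset_span ⟨v, hv, rfl⟩)

lemma IsRationalPolyhedral.le_of_latticeVec_mem (hσ : IsRationalPolyhedral σ)
    {τ : PointedCone ℝ (ℝ ⊗[ℤ] N)} (h : ∀ v : N, latticeVec v ∈ σ → latticeVec v ∈ τ) :
    σ ≤ τ := by
  obtain ⟨s, rfl⟩ := hσ
  refine Submodule.span_le.mpr ?_
  rintro _ ⟨v, hv, rfl⟩
  exact h v (Submodule.subset_span ⟨v, hv, rfl⟩)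

/-- The intersection of a cone with the hyperplane `w = 0`, a face of `σ` when `w ∈ σ^∨`. -/
noncomputable def faceCone (σ : PointedCone ℝ (ℝ ⊗[ℤ] N)) (w : Module.Dual ℤ N) :
    PointedCone ℝ (ℝ ⊗[ℤ] N) :=
  σ ⊓ (LinearMap.ker (pairing w)).restrictScalars _

lemma faceCone_le (w : Module.Dual ℤ N) : faceCone σ w ≤ σ := inf_le_left

lemma latticeVec_mem_faceCone {w : Module.Dual ℤ N} {v : N} :
    latticeVec v ∈ faceCone σ w ↔ latticeVec v ∈ σ ∧ w v = 0 := by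
  change latticeVec v ∈ σ ∧ pairing w (latticeVec v) = 0 ↔ _
  rw [pairing_latticeVec, Int.cast_eq_zero]

lemma isFace_faceCone {w : Module.Dual ℤ N} (hw : w ∈ dualMonoid σ) : IsFace (faceCone σ w) σ :=
  ⟨pairing w, hw, fun _ => Iff.rfl⟩

lemma latticeVec_mem_hull_singleton_of_zsmul_eq {v w : N} {c d : ℤ} (hc : 0 < c) (hd : 0 ≤ d)
    (h : c • v = d • w) : latticeVec v ∈ PointedCone.hull ℝ {latticeVec w} := by
  have hc' : (0 : ℝ) < c := by exact_mod_cast hc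
  have hd' : (0 : ℝ) ≤ d := by exact_mod_cast hd
  have key : latticeVec v = ((c : ℝ)⁻¹ * d) • latticeVec w := by
    rw [mul_smul, ← latticeVec_zsmul, ← h, latticeVec_zsmul, inv_smul_smul₀ hc'.ne']
  rw [key]
  exact Submodule.smul_mem _ (⟨_, mul_nonneg (inv_nonneg.mpr hc'.le) hd'⟩ : {x : ℝ // 0 ≤ x})
    (Submodule.mem_span_singleton_self _)

/-- Minimizing the ratio `m / u` over the generators of `σ`: the minimum is attained along a face
of `σ`, cut out by a combination of `m` and `u`. -/
lemma IsRationalPolyhedral.exists_smul_sub_smul_mem_dualMonoid (hσ : IsRationalPolyhedral σ)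
    (h0 : σ ≠ ⊥) {u : Module.Dual ℤ N} (hu : ∀ v : N, latticeVec v ∈ σ → v ≠ 0 → 0 < u v)
    (m : Module.Dual ℤ N) :
    ∃ v : N, v ≠ 0 ∧ latticeVec v ∈ σ ∧ u v • m - m v • u ∈ dualMonoid σ := by
  classical
  obtain ⟨s, rfl⟩ := hσ
  have hs : ∀ v ∈ s, latticeVec v ∈ PointedCone.hull ℝ (latticeVec '' (s : Set N)) :=
    fun v hv => Submodule.subset_span ⟨v, hv, rfl⟩
  have hne : (s.filter (· ≠ 0)).Nonempty := by
    by_contra! h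
    refine h0 (Submodule.span_eq_bot.mpr ?_)
    rintro _ ⟨v, hv, rfl⟩
    rw [not_not.mp (Finset.filter_eq_empty_iff.mp h hv), latticeVec_zero]
  obtain ⟨v, hv, hmin⟩ := (s.filter (· ≠ 0)).exists_min_image (fun v => (m v : ℚ) / u v) hne
  obtain ⟨hvs, hv0⟩ := Finset.mem_filter.mp hv
  refine ⟨v, hv0, hs v hvs, mem_dualMonoid_hull.mpr fun w hw => ?_⟩
  by_cases hw0 : w = 0
  · rw [hw0, map_zero]
  have hratio := hmin w (Finset.mem_filter.mpr ⟨hw, hw0⟩)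
  rw [div_le_div_iff₀ (by exact_mod_cast hu v (hs v hvs) hv0)
    (by exact_mod_cast hu w (hs w hw) hw0)] at hratio
  have hcross : m v * u w ≤ m w * u v := by exact_mod_cast hratio
  simp only [LinearMap.sub_apply, LinearMap.smul_apply, smul_eq_mul]
  linarith [mul_comm (u v) (m w)]

end RationalCones

section Primitive

variable {N : Type u} [AddCommGroup N]

lemma exists_isPrimitiveVec_eq_zsmul_of_pos {v : N} {u : Module.Dual ℤ N} (hu : 0 < u v) :
    ∃ w : N, IsPrimitiveVec w ∧ ∃ d : ℤ, 0 < d ∧ v = d • w := by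
  induction h : (u v).natAbs using Nat.strong_induction_on generalizing v with
  | _ n ih =>
    by_cases hv : IsPrimitiveVec v
    · exact ⟨v, hv, 1, one_pos, (one_smul ℤ v).symm⟩
    unfold IsPrimitiveVec at hv
    push Not at hv
    obtain ⟨c, w, rfl, hc⟩ := hv
    have hcw : |c| • c.sign • w = c • w := by rw [smul_smul, mul_comm, Int.sign_mul_abs]
    rw [← hcw, map_smul, smul_eq_mul] at hu h
    have hc0 : 0 < |c| := abs_pos.mpr fun h0 => by simp [h0] at hu
    have hc1 : 1 < |c| := by
      rw [Int.isUnit_iff_abs_eq] at hc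
      lia
    have hpos : 0 < u (c.sign • w) := (pos_iff_pos_of_mul_pos hu).mp hc0
    have hlt : (u (c.sign • w)).natAbs < n := h ▸
      Int.natAbs_lt_natAbs_of_nonneg_of_lt hpos.le (lt_mul_of_one_lt_left hpos hc1)
    obtain ⟨w', hw', d, hd, hwd⟩ := ih _ hlt hpos rfl
    exact ⟨w', hw', |c| * d, by positivity, by rw [← hcw, hwd, smul_smul]⟩

variable [Module.Free ℤ N]

lemma eq_of_forall_dual_eq {v w : N} (h : ∀ u : Module.Dual ℤ N, u v = u w) : v = w :=
  Module.eval_apply_injective ℤ (LinearMap.ext h)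

lemma latticeVec_eq_zero {v : N} : latticeVec v = 0 ↔ v = 0 := by
  refine ⟨fun h => eq_of_forall_dual_eq fun u => ?_, fun h => h ▸ latticeVec_zero⟩
  have := pairing_latticeVec u v
  rw [h, map_zero] at this
  rw [map_zero]
  exact_mod_cast this.symm

end Primitive

section FanRays

variable {N : Type u} [AddCommGroup N] [Module.Free ℤ N]

/-- The relation `u(v) m = m(v) u` holds along a nonzero face, so by minimality on all of `τ`;
letting `m` vary, any two lattice vectors of `τ` are proportional. -/
lemma Fan.smul_eq_smul_of_minimal (Δ : Fan N) {τ : PointedCone ℝ (ℝ ⊗[ℤ] N)}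
    (hτ : Minimal (fun τ => τ ∈ Δ.cones ∧ τ ≠ ⊥) τ)
    {u : Module.Dual ℤ N} (hu : ∀ v : N, latticeVec v ∈ τ → v ≠ 0 → 0 < u v) {x y : N}
    (hx : latticeVec x ∈ τ) (hy : latticeVec y ∈ τ) : u x • y = u y • x := by
  refine eq_of_forall_dual_eq fun m => ?_
  obtain ⟨v, hv0, hv, hd⟩ := (Δ.rational τ hτ.prop.1).exists_smul_sub_smul_mem_dualMonoid
    hτ.prop.2 hu m
  have hvface : latticeVec v ∈ faceCone τ (u v • m - m v • u) :=
    latticeVec_mem_faceCone.mpr ⟨hv, by simp [mul_comm]⟩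
  have hface : faceCone τ (u v • m - m v • u) ≠ ⊥ := fun h =>
    hv0 (latticeVec_eq_zero.mp ((Submodule.mem_bot _).mp (h ▸ hvface)))
  have hle := hτ.le_of_le ⟨Δ.face_mem τ hτ.prop.1 _ (isFace_faceCone hd), hface⟩ (faceCone_le _)
  have hprop : ∀ z : N, latticeVec z ∈ τ → u v * m z = m v * u z := fun z hz =>
    sub_eq_zero.mp (latticeVec_mem_faceCone.mp (hle hz)).2
  rw [map_smul, map_smul, smul_eq_mul, smul_eq_mul]
  refine mul_left_cancel₀ (hu v hv hv0).ne' ?_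
  linear_combination u x * hprop y hy - u y * hprop x hx

variable [Module.Finite ℤ N]

lemma IsPrimitiveVec.ne_zero {v : N} (hv : IsPrimitiveVec v) : v ≠ 0 := by
  rintro rfl
  obtain ⟨u, hu⟩ := hv.exists_dual
  simp at hu

namespace Fan

variable (Δ : Fan N) {σ τ : PointedCone ℝ (ℝ ⊗[ℤ] N)}

lemma exists_forall_pos (hσ : σ ∈ Δ.cones) :
    ∃ u ∈ dualMonoid σ, ∀ v : N, latticeVec v ∈ σ → v ≠ 0 → 0 < u v := by
  obtain ⟨u, hu, hbot⟩ := (Δ.isFace_of_le (τ := Δ.zeroCone) (σ := ⟨σ, hσ⟩)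
    (bot_le (a := σ))).exists_dual (Δ.rational _ hσ)
  refine ⟨u, hu, fun v hv hv0 => (nonneg_of_mem_dualMonoid hu hv).lt_of_ne fun h0 => hv0 ?_⟩
  have : latticeVec v ∈ (⊥ : PointedCone ℝ (ℝ ⊗[ℤ] N)) :=
    (hbot _).mpr ⟨hv, by rw [pairing_latticeVec, ← h0, Int.cast_zero]⟩
  exact latticeVec_eq_zero.mp ((Submodule.mem_bot _).mp this)

lemma exists_ray_eq_of_minimal (hτ : Minimal (fun τ => τ ∈ Δ.cones ∧ τ ≠ ⊥) τ) :
    ∃ v : Δ.Ray, τ = Δ.rayCone v := by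
  obtain ⟨u, huτ, hu⟩ := Δ.exists_forall_pos hτ.prop.1
  obtain ⟨v, hv0, hv, -⟩ := (Δ.rational τ hτ.prop.1).exists_smul_sub_smul_mem_dualMonoid
    hτ.prop.2 hu 0
  obtain ⟨w, hw, d, hd, rfl⟩ := exists_isPrimitiveVec_eq_zsmul_of_pos (hu v hv hv0)
  have hwτ : latticeVec w ∈ τ := (Submodule.span_singleton_le_iff_mem _ _).mpr hv
    (latticeVec_mem_hull_singleton_of_zsmul_eq hd zero_le_one (one_smul ℤ (d • w)).symm)
  have hτw : τ = PointedCone.hull ℝ {latticeVec w} := le_antisymm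
    ((Δ.rational τ hτ.prop.1).le_of_latticeVec_mem fun x hx =>
      latticeVec_mem_hull_singleton_of_zsmul_eq (hu w hwτ hw.ne_zero)
        (nonneg_of_mem_dualMonoid huτ hx)
        (Δ.smul_eq_smul_of_minimal hτ hu hwτ hx))
    ((Submodule.span_singleton_le_iff_mem _ _).mpr hwτ)
  exact ⟨⟨w, hw, hτw ▸ hτ.prop.1⟩, hτw⟩

lemma exists_ray_mem (hσ : σ ∈ Δ.cones) (h0 : σ ≠ ⊥) : ∃ v : Δ.Ray, latticeVec v.1 ∈ σ := by
  have hfin : {τ | τ ∈ Δ.cones ∧ τ ≠ ⊥}.Finite := Δ.finite.subset fun _ h => h.1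
  obtain ⟨τ, hτσ, hτ⟩ := hfin.exists_le_minimal ⟨hσ, h0⟩
  obtain ⟨v, rfl⟩ := Δ.exists_ray_eq_of_minimal hτ
  exact ⟨v, hτσ (Submodule.mem_span_singleton_self _)⟩

/-- The dual form of the fact that a cone of a fan is generated by its rays. -/
lemma mem_dualMonoid_iff (hσ : σ ∈ Δ.cones) {m : Module.Dual ℤ N} :
    m ∈ dualMonoid σ ↔ ∀ v : Δ.Ray, latticeVec v.1 ∈ σ → 0 ≤ m v.1 := by
  refine ⟨fun h v hv => nonneg_of_mem_dualMonoid h hv, fun hm => ?_⟩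
  have hrat := Δ.rational σ hσ
  rw [hrat.mem_dualMonoid_iff]
  intro x hx
  by_contra! hneg
  have hx0 : x ≠ 0 := by
    rintro rfl
    exact hneg.ne (map_zero m)
  have hσ0 : σ ≠ ⊥ := by
    rintro rfl
    exact hx0 (latticeVec_eq_zero.mp ((Submodule.mem_bot _).mp hx))
  obtain ⟨u, -, hu⟩ := Δ.exists_forall_pos hσ
  obtain ⟨v, hv0, hv, hd⟩ := hrat.exists_smul_sub_smul_mem_dualMonoid hσ0 hu m
  have hvface : latticeVec v ∈ faceCone σ (u v • m - m v • u) :=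
    latticeVec_mem_faceCone.mpr ⟨hv, by simp [mul_comm]⟩
  obtain ⟨r, hr⟩ := Δ.exists_ray_mem (Δ.face_mem σ hσ _ (isFace_faceCone hd)) fun h =>
    hv0 (latticeVec_eq_zero.mp ((Submodule.mem_bot _).mp (h ▸ hvface)))
  obtain ⟨hrσ, hr0⟩ := latticeVec_mem_faceCone.mp hr
  have hmx : m v * u x ≤ u v * m x := sub_nonneg.mp (nonneg_of_mem_dualMonoid hd hx)
  have hmr : u v * m r.1 = m v * u r.1 := sub_eq_zero.mp hr0
  have huv := hu v hv hv0
  have hmv : m v < 0 := neg_of_mul_neg_left (hmx.trans_lt (mul_neg_of_pos_of_neg huv hneg))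
    (hu x hx hx0).le
  have hmv' : 0 ≤ m v * u r.1 := hmr ▸ mul_nonneg huv.le (hm r hrσ)
  exact hmv'.not_gt (mul_neg_of_neg_of_pos hmv (hu r.1 hrσ r.2.1.ne_zero))

end Fan

end FanRays

section Polytope

variable {N : Type u} [AddCommGroup N]

namespace Fan

variable (Δ : Fan N)

lemma mem_dualMonoid_zeroCone (u : Module.Dual ℤ N) : u ∈ dualMonoid Δ.zeroCone.1 := fun x hx => by
  rw [(Submodule.mem_bot _).mp hx, map_zero]

lemma zeroCone_le (σ : Δ.Cone) : Δ.zeroCone ≤ σ := bot_le (a := σ.1)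

/-- Completeness of a fan, in valuative form: every homomorphism from `M` to a linearly ordered
abelian group is nonnegative on some `σ^∨ ∩ M`. For `ℤ` this says that the cones cover `N`; the
groups of higher rank allow infinitesimal perturbations of a point of `N`. -/
def IsComplete : Prop :=
  ∀ (Γ : Type) [AddCommGroup Γ] [LinearOrder Γ] [IsOrderedAddMonoid Γ] (φ : Module.Dual ℤ N →+ Γ),
    ∃ σ : Δ.Cone, ∀ u ∈ dualMonoid σ.1, 0 ≤ φ u

/-- The lattice points of the polytope of the divisor `∑ a_v Y(v)`. -/
def polytope (a : Δ.Ray → ℤ) : Set (Module.Dual ℤ N) :=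
  {u | ∀ v, 0 ≤ u v.1 + a v}

/-- The combinatorial form of ampleness of `∑ a_v Y(v)`: the numbers `-a_v` are the values of a
function that is integral linear on each cone and, on a multiple, strictly convex. -/
structure IsStrictlyConvex (a : Δ.Ray → ℤ) : Prop where
  exists_integral (σ : Δ.Cone) :
    ∃ u : Module.Dual ℤ N, ∀ v : Δ.Ray, latticeVec v.1 ∈ σ.1 → u v.1 + a v = 0
  exists_strict (σ : Δ.Cone) : ∃ n : ℕ, 0 < n ∧ ∃ u ∈ Δ.polytope (n • a),
    ∀ v : Δ.Ray, u v.1 + (n • a) v = 0 ↔ latticeVec v.1 ∈ σ.1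

variable {Δ} {a : Δ.Ray → ℤ}

/-- On a full-dimensional cone the integral and the strictly convex linear functions agree up to a
multiple. -/
lemma IsStrictlyConvex.mem_polytope (ha : Δ.IsStrictlyConvex a) {σ : Δ.Cone}
    (hσ : ∀ u : Module.Dual ℤ N, (∀ v : Δ.Ray, latticeVec v.1 ∈ σ.1 → u v.1 = 0) → u = 0)
    {u : Module.Dual ℤ N} (hu : ∀ v : Δ.Ray, latticeVec v.1 ∈ σ.1 → u v.1 + a v = 0) :
    u ∈ Δ.polytope a := by
  obtain ⟨n, hn, u', hu', hzero⟩ := ha.exists_strict σ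
  have heq : (n : ℤ) • u = u' := sub_eq_zero.mp <| hσ _ fun v hv => by
    have h1 := hu v hv
    have h2 := (hzero v).mpr hv
    simp only [LinearMap.sub_apply, LinearMap.smul_apply, Pi.smul_apply, nsmul_eq_mul,
      smul_eq_mul] at h2 ⊢
    linear_combination (n : ℤ) * h1 - h2
  intro v
  have h := hu' v
  simp only [← heq, LinearMap.smul_apply, Pi.smul_apply, nsmul_eq_mul, smul_eq_mul,
    ← mul_add] at h
  exact nonneg_of_mul_nonneg_right h (by exact_mod_cast hn)

variable [Module.Free ℤ N] [Module.Finite ℤ N]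

/-- A lexicographic perturbation of evaluation at `w` in the directions of a basis is injective, so
the cone it selects is full-dimensional. -/
lemma IsComplete.exists_cone_spanning (hΔ : Δ.IsComplete) (w : N) :
    ∃ σ : Δ.Cone, (∀ u ∈ dualMonoid σ.1, 0 ≤ u w) ∧
      ∀ u : Module.Dual ℤ N, (∀ v : Δ.Ray, latticeVec v.1 ∈ σ.1 → u v.1 = 0) → u = 0 := by
  let b := Module.finBasis ℤ N
  let φ : Module.Dual ℤ N →+ ℤ ×ₗ Lex (Fin (Module.finrank ℤ N) → ℤ) :=
    { toFun := fun u => toLex (u w, toLex fun i => u (b i))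
      map_zero' := rfl
      map_add' := fun _ _ => rfl }
  obtain ⟨σ, hσ⟩ := hΔ _ φ
  refine ⟨σ, fun u hu => ?_, fun u hu => b.ext fun i => ?_⟩
  · by_contra! hlt
    exact (hσ u hu).not_gt (Prod.Lex.toLex_lt_toLex.mpr (Or.inl hlt))
  · have hpos : 0 ≤ φ u := hσ u ((Δ.mem_dualMonoid_iff σ.2).mpr fun v hv => (hu v hv).ge)
    have hneg : 0 ≤ φ (-u) := hσ (-u) ((Δ.mem_dualMonoid_iff σ.2).mpr fun v hv => by
      rw [LinearMap.neg_apply, hu v hv, neg_zero])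
    have hφ : φ u = 0 := le_antisymm (neg_nonneg.mp (map_neg φ u ▸ hneg)) hpos
    exact congrFun (congrArg (fun x => (ofLex x).2) hφ) i

/-- On the rays where `u + m a` vanishes, `n u - m u'` is nonpositive, while it lies in `σ^∨` and
is therefore nonnegative at the sum of these rays. -/
lemma latticeVec_mem_of_mem_polytope {σ : Δ.Cone} {m n : ℕ} (hm : 0 < m)
    {u u' : Module.Dual ℤ N} (hu : u ∈ Δ.polytope (m • a)) (hu' : u' ∈ Δ.polytope (n • a))
    (hσ : ∀ v : Δ.Ray, u' v.1 + (n • a) v = 0 ↔ latticeVec v.1 ∈ σ.1)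
    (hw : ∀ t ∈ dualMonoid σ.1, 0 ≤ t (∑ v : Δ.Ray with u v.1 + (m • a) v = 0, v.1))
    {v : Δ.Ray} (hv : u v.1 + (m • a) v = 0) : latticeVec v.1 ∈ σ.1 := by
  have heval : ∀ v : Δ.Ray, ((n : ℤ) • u - (m : ℤ) • u') v.1 =
      n * (u v.1 + (m • a) v) - m * (u' v.1 + (n • a) v) := fun v => by
    simp only [LinearMap.sub_apply, LinearMap.smul_apply, Pi.smul_apply, nsmul_eq_mul, smul_eq_mul]
    ring
  have hdual : (n : ℤ) • u - (m : ℤ) • u' ∈ dualMonoid σ.1 :=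
    (Δ.mem_dualMonoid_iff σ.2).mpr fun v hvσ => by
      rw [heval, (hσ v).mpr hvσ, mul_zero, sub_zero]
      exact mul_nonneg (Nat.cast_nonneg n) (hu v)
  have hnonpos : ∀ v : Δ.Ray, v ∈ Finset.univ.filter (fun v => u v.1 + (m • a) v = 0) →
      ((n : ℤ) • u - (m : ℤ) • u') v.1 ≤ 0 := fun v hv => by
    rw [heval, (Finset.mem_filter.mp hv).2, mul_zero, zero_sub]
    exact neg_nonpos.mpr (mul_nonneg (Nat.cast_nonneg m) (hu' v))
  have hzero : ((n : ℤ) • u - (m : ℤ) • u') v.1 = 0 :=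
    (Finset.sum_eq_zero_iff_of_nonpos hnonpos).mp
      (le_antisymm (Finset.sum_nonpos hnonpos) (map_sum ((n : ℤ) • u - (m : ℤ) • u') _ _ ▸
        hw _ hdual)) v (Finset.mem_filter.mpr ⟨Finset.mem_univ v, hv⟩)
  rw [heval, hv, mul_zero, zero_sub, neg_eq_zero] at hzero
  exact (hσ v).mp ((mul_eq_zero.mp hzero).resolve_left (by exact_mod_cast hm.ne'))

namespace IsStrictlyConvex

lemma exists_cone_of_mem_polytope (ha : Δ.IsStrictlyConvex a) (hΔ : Δ.IsComplete)
    {u : Module.Dual ℤ N} (hu : u ∈ Δ.polytope a) :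
    ∃ σ : Δ.Cone, ∀ v : Δ.Ray, u v.1 + a v = 0 → latticeVec v.1 ∈ σ.1 := by
  rw [← one_smul ℕ a] at hu
  obtain ⟨σ, hσ, -⟩ := hΔ.exists_cone_spanning (∑ v : Δ.Ray with u v.1 + (1 • a) v = 0, v.1)
  obtain ⟨n, -, u', hu', hzero⟩ := ha.exists_strict σ
  refine ⟨σ, fun v hv => latticeVec_mem_of_mem_polytope one_pos hu hu' hzero hσ ?_⟩
  rwa [one_smul]

lemma exists_mem_polytope (ha : Δ.IsStrictlyConvex a) (hΔ : Δ.IsComplete) (σ : Δ.Cone) :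
    ∃ u ∈ Δ.polytope a, ∀ v : Δ.Ray, latticeVec v.1 ∈ σ.1 → u v.1 + a v = 0 := by
  obtain ⟨m, hm, t, ht, htσ⟩ := ha.exists_strict σ
  obtain ⟨σ', hσ', hspan⟩ :=
    hΔ.exists_cone_spanning (∑ v : Δ.Ray with t v.1 + (m • a) v = 0, v.1)
  obtain ⟨n, -, t', ht', htσ'⟩ := ha.exists_strict σ'
  obtain ⟨u, hu⟩ := ha.exists_integral σ'
  exact ⟨u, ha.mem_polytope hspan hu, fun v hv =>
    hu v (latticeVec_mem_of_mem_polytope hm ht ht' htσ' hσ' ((htσ v).mpr hv))⟩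

end IsStrictlyConvex

end Fan

end Polytope

section IrrelevantIdeal

/-- Setting to zero the variables that do not occur in an exponent `e` kills every generator that
does not divide `X ^ e`, but preserves the coefficient at `e`. -/
lemma isRadical_span_monomial_of_le_one {ι R : Type*} [CommRing R] [IsReduced R] {S : Set (ι →₀ ℕ)}
    (hS : ∀ s ∈ S, ∀ i, s i ≤ 1) :
    (Ideal.span ((fun s => MvPolynomial.monomial s (1 : R)) '' S)).IsRadical := by
  rintro F ⟨n, hn⟩
  rw [MvPolynomial.mem_ideal_span_monomial_image]
  by_contra! hF
  obtain ⟨e, he, hSe⟩ := hF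
  have hsub : (e.support : Set ι) ⊆ Set.range ((↑) : {i // e i ≠ 0} → ι) :=
    fun i hi => ⟨⟨i, Finsupp.mem_support_iff.mp hi⟩, rfl⟩
  have hker : Ideal.span ((fun s => MvPolynomial.monomial s (1 : R)) '' S) ≤
      RingHom.ker (MvPolynomial.killCompl (R := R) (Subtype.val_injective (p := (e · ≠ 0)))) := by
    refine Ideal.span_le.mpr ?_
    rintro _ ⟨s, hs, rfl⟩
    refine MvPolynomial.killCompl_monomial_eq_zero_of_not_subset _ _ fun hse => hSe s hs fun i => ?_
    by_cases hi : s i = 0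
    · exact hi ▸ Nat.zero_le _
    · obtain ⟨j, rfl⟩ := hse (Finsupp.mem_support_iff.mpr hi)
      exact (hS s hs j).trans (Nat.one_le_iff_ne_zero.mpr j.2)
  have hpow := RingHom.mem_ker.mp (hker hn)
  rw [map_pow] at hpow
  refine MvPolynomial.mem_support_iff.mp he ?_
  rw [← e.mapDomain_comapDomain _ Subtype.val_injective hsub,
    ← MvPolynomial.coeff_killCompl Subtype.val_injective,
    eq_zero_of_pow_eq_zero hpow, MvPolynomial.coeff_zero]

variable (k : Type u) [Field k] {N : Type u} [AddCommGroup N] [Module.Free ℤ N]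
  [Module.Finite ℤ N] (Δ : Fan N)

open Classical in
/-- The exponent vector of the monomial `∏_{v ∉ σ} v`. -/
noncomputable def offExponent (σ : Δ.Cone) : Δ.Ray →₀ ℕ :=
  Finsupp.equivFunOnFinite.symm fun v => if latticeVec v.1 ∉ σ.1 then 1 else 0

lemma irrelevantIdeal_eq_span_monomial : irrelevantIdeal k Δ =
    Ideal.span ((fun e => MvPolynomial.monomial e (1 : k)) '' Set.range (offExponent Δ)) := by
  classical
  rw [irrelevantIdeal, ← Set.range_comp]
  congr 2
  funext σ
  rw [Function.comp_apply, MvPolynomial.monomial_eq, map_one, one_mul,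
    Finsupp.prod_fintype _ _ fun _ => pow_zero _, Finset.prod_filter]
  refine Finset.prod_congr rfl fun v _ => ?_
  simp only [offExponent, Finsupp.equivFunOnFinite_symm_apply_apply]
  split_ifs <;> simp

variable {k Δ}

lemma offExponent_le_iff {σ : Δ.Cone} {e : Δ.Ray →₀ ℕ} :
    offExponent Δ σ ≤ e ↔ ∀ v, latticeVec v.1 ∉ σ.1 → e v ≠ 0 := by
  refine Finsupp.le_def.trans (forall_congr' fun v => ?_)
  simp only [offExponent, Finsupp.equivFunOnFinite_symm_apply_apply]
  split_ifs with h
  · simp [h]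
  · simp [h, Nat.one_le_iff_ne_zero]

lemma isRadical_irrelevantIdeal : (irrelevantIdeal k Δ).IsRadical := by
  rw [irrelevantIdeal_eq_span_monomial]
  refine isRadical_span_monomial_of_le_one ?_
  rintro _ ⟨σ, rfl⟩ v
  simp only [offExponent, Finsupp.equivFunOnFinite_symm_apply_apply]
  split_ifs <;> simp

lemma mem_irrelevantIdeal {F : CoxRing k Δ} :
    F ∈ irrelevantIdeal k Δ ↔
      ∀ e ∈ F.support, ∃ σ : Δ.Cone, ∀ v, latticeVec v.1 ∉ σ.1 → e v ≠ 0 := by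
  rw [irrelevantIdeal_eq_span_monomial, MvPolynomial.mem_ideal_span_monomial_image]
  simp only [Set.exists_range_iff, offExponent_le_iff]

lemma exists_mem_support_of_mem_support_homogenize {a : Δ.Ray → ℤ}
    {p : ChartRing k Δ.zeroCone.1} {e : Δ.Ray →₀ ℕ} (he : e ∈ (homogenize k Δ a p).support) :
    ∃ u ∈ p.coeff.support, ∀ v, e v = (u.1 v.1 + a v).toNat := by
  classical
  obtain ⟨u, hu, heu⟩ := Finset.mem_biUnion.mp (MvPolynomial.support_sum he)
  have := Finset.mem_singleton.mp (MvPolynomial.support_monomial_subset heu)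
  exact ⟨u, hu, fun v => by rw [this]; rfl⟩

lemma homogenize_single (a : Δ.Ray → ℤ) (u : dualMonoid Δ.zeroCone.1) (c : k) :
    homogenize k Δ a (.single u c) = MvPolynomial.monomial
      (Finsupp.equivFunOnFinite.symm fun v : Δ.Ray => (u.1 v.1 + a v).toNat) c :=
  Finsupp.sum_single_index (MvPolynomial.monomial_zero)

namespace Fan

variable {a : Δ.Ray → ℤ}

lemma IsStrictlyConvex.homogenize_mem_irrelevantIdeal (ha : Δ.IsStrictlyConvex a)
    (hΔ : Δ.IsComplete) {p : ChartRing k Δ.zeroCone.1}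
    (hp : ∀ u ∈ p.coeff.support, u.1 ∈ Δ.polytope a) :
    homogenize k Δ a p ∈ irrelevantIdeal k Δ := by
  refine mem_irrelevantIdeal.mpr fun e he => ?_
  obtain ⟨u, hu, hue⟩ := exists_mem_support_of_mem_support_homogenize he
  obtain ⟨σ, hσ⟩ := ha.exists_cone_of_mem_polytope hΔ (hp u hu)
  refine ⟨σ, fun v hv hev => hv (hσ v (le_antisymm ?_ (hp u hu v)))⟩
  exact Int.toNat_eq_zero.mp ((hue v).symm.trans hev)

lemma IsStrictlyConvex.irrelevantIdeal_le_radical (ha : Δ.IsStrictlyConvex a)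
    (hΔ : Δ.IsComplete) {I : Ideal (CoxRing k Δ)}
    (hI : ∀ u ∈ Δ.polytope a, homogenize k Δ a (.single ⟨u, Δ.mem_dualMonoid_zeroCone u⟩ 1) ∈ I) :
    irrelevantIdeal k Δ ≤ I.radical := by
  rw [irrelevantIdeal_eq_span_monomial, Ideal.span_le]
  rintro _ ⟨_, ⟨σ, rfl⟩, rfl⟩
  obtain ⟨u, hu, huσ⟩ := ha.exists_mem_polytope hΔ σ
  have hmem := hI u hu
  rw [homogenize_single] at hmem
  let d : ℕ := 1 + ∑ v : Δ.Ray, (u v.1 + a v).toNat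
  refine ⟨d, Ideal.mem_of_dvd _ ?_ hmem⟩
  rw [MvPolynomial.monomial_pow, one_pow, MvPolynomial.monomial_dvd_monomial]
  refine ⟨Or.inr (Finsupp.le_def.mpr fun v => ?_), dvd_rfl⟩
  simp only [offExponent, Finsupp.smul_apply, Finsupp.equivFunOnFinite_symm_apply_apply]
  split_ifs with hv
  · rw [huσ v hv]
    exact Nat.zero_le _
  · rw [smul_eq_mul, mul_one]
    exact (Finset.single_le_sum (f := fun v : Δ.Ray => (u v.1 + a v).toNat)
      (fun _ _ => Nat.zero_le _) (Finset.mem_univ v)).trans (Nat.le_add_left _ _)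

end Fan

end IrrelevantIdeal

section Completeness

variable (k : Type u) [Field k] {N : Type u} [AddCommGroup N] [Module.Finite ℤ N] (Δ : Fan N)

lemma chart_toSpec (σ : Δ.Cone) : chart k Δ σ ≫ toricVarietyToSpec k Δ =
    Spec.map (CommRingCat.ofHom (algebraMap k (ChartRing k σ.1))) :=
  Limits.colimit.ι_desc _ _

lemma chartMap_chart {τ σ : Δ.Cone} (h : τ ≤ σ) :
    Spec.map (CommRingCat.ofHom (chartMap k h)) ≫ chart k Δ σ = chart k Δ τ :=
  chartDiagram_map_chart k Δ (homOfLE h)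

variable {k Δ}

lemma exists_chart_comp_eq_of_isLocalRing {R : Type u} [CommRing R] [IsLocalRing R]
    (l : Spec (.of R) ⟶ toricVariety k Δ) : ∃ (σ : Δ.Cone) (θ : ChartRing k σ.1 →+* R),
      Spec.map (CommRingCat.ofHom θ) ≫ chart k Δ σ = l := by
  obtain ⟨σ, y, hy⟩ := exists_chart k Δ (l (IsLocalRing.closedPoint R))
  have hrange : Set.range l ⊆ Set.range (chart k Δ σ) := by
    rintro _ ⟨x, rfl⟩
    exact ((IsLocalRing.specializes_closedPoint x).map l.continuous).mem_open
      (chart k Δ σ).isOpenEmbedding.isOpen_range ⟨y, hy⟩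
  refine ⟨σ, (Spec.preimage (IsOpenImmersion.lift (chart k Δ σ) l hrange)).hom, ?_⟩
  rw [CommRingCat.ofHom_hom, Spec.map_preimage, IsOpenImmersion.lift_fac]

lemma exists_cone_forall_mem_valuationSubring [UniversallyClosed (toricVarietyToSpec k Δ)]
    {K : Type u} [Field K] (O : ValuationSubring K) (ψ : ChartRing k Δ.zeroCone.1 →+* K)
    (hψ : ∀ c : k, ψ (algebraMap k _ c) ∈ O) :
    ∃ σ : Δ.Cone, ∀ x, ψ (chartMap k (Δ.zeroCone_le σ) x) ∈ O := by
  let c : k →+* O := (ψ.comp (algebraMap k _)).codRestrict O.toSubring hψ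
  let S : ValuativeCommSq (toricVarietyToSpec k Δ) :=
    { R := O
      K := K
      i₁ := Spec.map (CommRingCat.ofHom ψ) ≫ chart k Δ Δ.zeroCone
      i₂ := Spec.map (CommRingCat.ofHom c)
      commSq := ⟨by
        rw [Category.assoc, chart_toSpec, ← Spec.map_comp, ← Spec.map_comp]
        rfl⟩ }
  have hvc : UniversallyClosed (toricVarietyToSpec k Δ) := inferInstance
  rw [UniversallyClosed.eq_valuativeCriterion] at hvc
  obtain ⟨⟨l, hl, -⟩⟩ := (hvc.1 S).exists_lift
  obtain ⟨σ, θ, rfl⟩ := exists_chart_comp_eq_of_isLocalRing l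
  change Spec.map (CommRingCat.ofHom (algebraMap O K)) ≫ Spec.map (CommRingCat.ofHom θ) ≫ _ =
    Spec.map (CommRingCat.ofHom ψ) ≫ chart k Δ Δ.zeroCone at hl
  rw [← chartMap_chart k Δ (Δ.zeroCone_le σ), ← Category.assoc, ← Category.assoc,
    cancel_mono, ← Spec.map_comp, ← Spec.map_comp] at hl
  refine ⟨σ, fun x => ?_⟩
  have hx : algebraMap O K (θ x) = ψ (chartMap k (Δ.zeroCone_le σ) x) :=
    congrArg (fun f => f.hom x) (Spec.map_injective hl)
  exact hx ▸ (θ x).2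

section Hahn

variable {Γ : Type*} [AddCommGroup Γ] [LinearOrder Γ] [IsOrderedAddMonoid Γ]

/-- The homomorphism from a monoid algebra to Hahn series sending the monomial `x^u` to `t^φ(u)`:
composed with the valuation of Hahn series, it extends the weight `φ` to a valuation. -/
noncomputable def weightHom (k : Type u) [Field k] {M : Type*} [AddCommMonoid M] (φ : M →+ Γ) :
    AddMonoidAlgebra k M →ₐ[k] HahnSeries Γ k :=
  AddMonoidAlgebra.lift k _ _
    { toFun := fun u => HahnSeries.single (φ u.toAdd) 1
      map_one' := by simp
      map_mul' := fun x y => by simp }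

lemma weightHom_single {M : Type*} [AddCommMonoid M] (φ : M →+ Γ) (u : M) :
    weightHom k φ (.single u 1) = HahnSeries.single (φ u) 1 := by
  refine (AddMonoidAlgebra.lift_single _ _ _).trans ?_
  rw [one_smul]
  rfl

variable (Γ k) in
/-- The valuation ring of Hahn series of nonnegative order. -/
noncomputable abbrev hahnIntegers : ValuationSubring (HahnSeries Γ k) :=
  (AddValuation.toValuation (HahnSeries.addVal Γ k)).valuationSubring

lemma mem_hahnIntegers {x : HahnSeries Γ k} : x ∈ hahnIntegers k Γ ↔ 0 ≤ x.orderTop := by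
  rw [← HahnSeries.addVal_apply]
  rfl

end Hahn

lemma Fan.isComplete_of_universallyClosed (k : Type u) [Field k] (Δ : Fan N)
    [UniversallyClosed (toricVarietyToSpec k Δ)] : Δ.IsComplete := by
  intro Γ _ _ _ φ
  let ψ := weightHom k (φ.comp (dualMonoid Δ.zeroCone.1).subtype)
  obtain ⟨σ, hσ⟩ := exists_cone_forall_mem_valuationSubring (hahnIntegers k Γ) ψ.toRingHom
    fun c => by
      rw [mem_hahnIntegers, AlgHom.toRingHom_eq_coe, RingHom.coe_coe, AlgHom.commutes]
      exact HahnSeries.orderTop_single_le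
  refine ⟨σ, fun u hu => ?_⟩
  have hmem : ψ (.single ⟨u, Δ.mem_dualMonoid_zeroCone u⟩ 1) ∈ hahnIntegers k Γ :=
    chartMap_single k (Δ.zeroCone_le σ) ⟨u, hu⟩ 1 ▸ hσ (.single ⟨u, hu⟩ 1)
  rw [weightHom_single, mem_hahnIntegers, HahnSeries.orderTop_single one_ne_zero] at hmem
  exact_mod_cast hmem

end Completeness

section RegularFunctions

variable {X : Scheme.{u}} [AlgebraicGeometry.IsIntegral X]

/-- The local ring of `X` at `y` as a subring of the function field. -/
noncomputable def regularAt (y : X) : Subring X.functionField :=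
  (algebraMap (X.presheaf.stalk y) X.functionField).range

lemma algebraMap_stalk_injective (y : X) :
    Function.Injective (algebraMap (X.presheaf.stalk y) X.functionField) :=
  IsFractionRing.injective _ _

lemma inv_algebraMap_mem_regularAt_iff {y : X} {r : X.presheaf.stalk y} (hr : r ≠ 0) :
    (algebraMap (X.presheaf.stalk y) X.functionField r)⁻¹ ∈ regularAt y ↔ IsUnit r := by
  have hr' : algebraMap (X.presheaf.stalk y) X.functionField r ≠ 0 := by
    rwa [Ne, map_eq_zero_iff _ (algebraMap_stalk_injective y)]
  constructor
  · rintro ⟨s, hs⟩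
    refine IsUnit.of_mul_eq_one s (algebraMap_stalk_injective y ?_)
    rw [map_mul, hs, map_one, mul_inv_cancel₀ hr']
  · rintro ⟨s, rfl⟩
    refine ⟨(s⁻¹ : (X.presheaf.stalk y)ˣ), eq_inv_of_mul_eq_one_left ?_⟩
    rw [← map_mul, Units.inv_mul, map_one]

lemma ne_zero_of_inv_notMem_regularAt {y : X} {f : X.functionField} (h : f⁻¹ ∉ regularAt y) :
    f ≠ 0 := by
  rintro rfl
  rw [inv_zero] at h
  exact h (zero_mem _)

lemma exists_inv_mem_regularAt_of_sum {ι : Type*} {y : X} {s : Finset ι} {f : ι → X.functionField}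
    (hf : ∀ i ∈ s, f i ∈ regularAt y) (h0 : ∑ i ∈ s, f i ≠ 0)
    (h : (∑ i ∈ s, f i)⁻¹ ∈ regularAt y) : ∃ i ∈ s, f i ≠ 0 ∧ (f i)⁻¹ ∈ regularAt y := by
  choose! r hr using hf
  have hsum : algebraMap (X.presheaf.stalk y) X.functionField (∑ i ∈ s, r i) = ∑ i ∈ s, f i := by
    rw [map_sum]
    exact Finset.sum_congr rfl hr
  have hne : ∑ i ∈ s, r i ≠ 0 := by
    intro h
    rw [← hsum, h, map_zero] at h0
    exact h0 rfl
  rw [← hsum, inv_algebraMap_mem_regularAt_iff hne] at h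
  obtain ⟨i, hi, hunit⟩ : ∃ i ∈ s, IsUnit (r i) := by
    by_contra! hcon
    exact (IsLocalRing.mem_maximalIdeal _).mp (Ideal.sum_mem _ hcon) h
  refine ⟨i, hi, ?_, ?_⟩
  · rw [← hr i hi, Ne, map_eq_zero_iff _ (algebraMap_stalk_injective y)]
    exact hunit.ne_zero
  · rwa [← hr i hi, inv_algebraMap_mem_regularAt_iff hunit.ne_zero]

lemma regularAt_le_of_specializes {z y : X} (h : z ⤳ y) : regularAt y ≤ regularAt z := by
  rintro _ ⟨r, rfl⟩
  refine ⟨(X.presheaf.stalkSpecializes h).hom r, ?_⟩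
  simp only [RingHom.algebraMap_toAlgebra]
  rw [← CommRingCat.comp_apply, TopCat.Presheaf.stalkSpecializes_comp]

section Sections

variable {U : X.Opens} [Nonempty U] {y : X}

lemma germToFunctionField_mem_regularAt (hy : y ∈ U) (h : Γ(X, U)) :
    X.germToFunctionField U h ∈ regularAt y :=
  ⟨X.presheaf.germ U y hy h, Scheme.algebraMap_germ_eq_germToFunctionField X hy h⟩

lemma germToFunctionField_ne_zero {h : Γ(X, U)} (h0 : h ≠ 0) :
    X.germToFunctionField U h ≠ 0 := by
  rwa [Ne, map_eq_zero_iff _ (Scheme.germToFunctionField_injective X U)]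

lemma inv_germToFunctionField_mem_regularAt_iff (hy : y ∈ U) {h : Γ(X, U)} (h0 : h ≠ 0) :
    (X.germToFunctionField U h)⁻¹ ∈ regularAt y ↔ y ∈ X.basicOpen h := by
  rw [← Scheme.algebraMap_germ_eq_germToFunctionField X hy, inv_algebraMap_mem_regularAt_iff,
    Scheme.mem_basicOpen _ _ _ hy]
  rwa [Ne, map_eq_zero_iff _ (germ_injective_of_isIntegral X y hy)]

lemma mem_primeIdealOf_iff {X : Scheme.{u}} {U : X.Opens} (hU : IsAffineOpen U) (y : U)
    (b : Γ(X, U)) : b ∈ (hU.primeIdealOf y).asIdeal ↔ y.1 ∉ X.basicOpen b := by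
  rw [hU.primeIdealOf_eq_map_closedPoint, Scheme.mem_basicOpen _ _ _ y.2]
  exact IsLocalRing.mem_maximalIdeal _

lemma mem_regularAt_iff_of_isAffineOpen (hU : IsAffineOpen U) (hy : y ∈ U) {f : X.functionField} :
    f ∈ regularAt y ↔ ∃ a b : Γ(X, U), y ∈ X.basicOpen b ∧
      f = X.germToFunctionField U a / X.germToFunctionField U b := by
  constructor
  · rintro ⟨r, rfl⟩
    let := TopCat.Presheaf.algebra_section_stalk X.presheaf ⟨y, hy⟩
    have := hU.isLocalization_stalk ⟨y, hy⟩
    obtain ⟨a, ⟨b, hb⟩, rfl⟩ := IsLocalization.exists_mk'_eq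
      (hU.primeIdealOf ⟨y, hy⟩).asIdeal.primeCompl r
    have hb0 : b ≠ 0 := by
      rintro rfl
      exact hb (zero_mem _)
    refine ⟨a, b, not_not.mp (mt (mem_primeIdealOf_iff hU ⟨y, hy⟩ b).mpr hb), ?_⟩
    rw [eq_div_iff (germToFunctionField_ne_zero hb0),
      ← Scheme.algebraMap_germ_eq_germToFunctionField X hy,
      ← Scheme.algebraMap_germ_eq_germToFunctionField X hy, ← map_mul]
    exact congrArg _ (IsLocalization.mk'_spec _ _ _)
  · rintro ⟨a, b, hb, rfl⟩
    rw [div_eq_mul_inv]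
    refine mul_mem (germToFunctionField_mem_regularAt hy a) ?_
    by_cases hb0 : b = 0
    · rw [hb0, map_zero, inv_zero]
      exact zero_mem _
    · exact (inv_germToFunctionField_mem_regularAt_iff hy hb0).mpr hb

lemma exists_germToFunctionField_eq_of_forall_mem_regularAt (hU : IsAffineOpen U)
    {f : X.functionField} (hf : ∀ y ∈ U, f ∈ regularAt y) :
    ∃ a : Γ(X, U), X.germToFunctionField U a = f := by
  -- The ideal of denominators of `f` lies in no maximal ideal.
  let ψ := (X.germToFunctionField U).hom
  let I : Ideal Γ(X, U) :=
    { carrier := {b | ∃ a, ψ a = ψ b * f}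
      add_mem' := by
        rintro b b' ⟨a, ha⟩ ⟨a', ha'⟩
        exact ⟨a + a', by rw [map_add, map_add, ha, ha', add_mul]⟩
      zero_mem' := ⟨0, by rw [map_zero, zero_mul]⟩
      smul_mem' := by
        rintro c b ⟨a, ha⟩
        exact ⟨c * a, by rw [smul_eq_mul, map_mul, map_mul, ha, mul_assoc]⟩ }
  have hI : I = ⊤ := by
    by_contra hne
    obtain ⟨m, hm, hle⟩ := Ideal.exists_le_maximal I hne
    let P : PrimeSpectrum Γ(X, U) := ⟨m, hm.isPrime⟩
    have hyU : hU.fromSpec P ∈ U := hU.range_fromSpec.le ⟨P, rfl⟩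
    obtain ⟨a, b, hb, hab⟩ := (mem_regularAt_iff_of_isAffineOpen hU hyU).mp (hf _ hyU)
    have hb0 : ψ b ≠ 0 := by
      refine germToFunctionField_ne_zero ?_
      rintro rfl
      rw [Scheme.mem_basicOpen _ _ _ hyU, map_zero] at hb
      exact not_isUnit_zero hb
    have hbI : b ∈ I := ⟨a, by rw [hab, mul_div_cancel₀ _ hb0]⟩
    have hbP : P ∈ hU.fromSpec ⁻¹ᵁ X.basicOpen b := hb
    rw [hU.fromSpec_preimage_basicOpen] at hbP
    exact hbP (hle hbI)
  obtain ⟨a, ha⟩ : (1 : Γ(X, U)) ∈ I := hI ▸ Submodule.mem_top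
  rw [map_one, one_mul] at ha
  exact ⟨a, ha⟩

end Sections

end RegularFunctions

section OrderOfVanishing

variable {X : Scheme.{u}}

lemma eq_of_specializes_of_coheight_eq_one {z y : X} (h : z ⤳ y) (hz : Order.coheight z = 1)
    (hy : Order.coheight y = 1) : z = y := by
  by_contra hne
  have hlt : y < z := lt_of_le_not_ge h fun h' =>
    hne (Specializes.antisymm h (Scheme.le_iff_specializes.mp h')).eq
  have := Order.coheight_strictAnti hlt (by rw [hz]; exact ENat.one_lt_top)
  rw [hz, hy] at this
  exact lt_irrefl _ this

lemma height_primeIdealOf {U : X.Opens} (hU : IsAffineOpen U) (z : U) :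
    (hU.primeIdealOf z).asIdeal.height = Order.coheight z.1 := by
  let := TopCat.Presheaf.algebra_section_stalk X.presheaf z
  have := hU.isLocalization_stalk z
  have h := IsLocalization.AtPrime.ringKrullDim_eq_height (hU.primeIdealOf z).asIdeal
    (X.presheaf.stalk z)
  rw [ringKrullDim_stalk_eq_coheight] at h
  exact_mod_cast h.symm

lemma mem_minimalPrimes_span_singleton_of_height_le_one {R : Type*} [CommRing R] [IsDomain R]
    {P : Ideal R} [P.IsPrime] (hP : P.height ≤ 1) {b : R} (hb : b ≠ 0) (hbP : b ∈ P) :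
    P ∈ (Ideal.span {b}).minimalPrimes := by
  refine ⟨⟨inferInstance, (Ideal.span_singleton_le_iff_mem _).mpr hbP⟩, ?_⟩
  rintro Q ⟨hQ, hbQ⟩ hle
  by_contra hnle
  have : P.FiniteHeight := ⟨Or.inr (hP.trans_lt ENat.one_lt_top).ne⟩
  have hlt := (Ideal.height_strict_mono_of_isPrime_of_isPrime
    (lt_of_le_not_ge hle hnle)).trans_le hP
  rw [Order.lt_one_iff, Ideal.height_eq_zero_iff, IsDomain.minimalPrimes_eq_singleton_bot,
    Set.mem_singleton_iff] at hlt
  rw [hlt, le_bot_iff, Ideal.span_singleton_eq_bot] at hbQ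
  exact hb hbQ

variable [AlgebraicGeometry.IsIntegral X] [IsLocallyNoetherian X]

lemma ord_one (z : X) : Scheme.ord (1 : X.functionField) z = 0 := by
  have := Scheme.ord_mul (x := z) (one_ne_zero (α := X.functionField)) one_ne_zero
  rw [mul_one] at this
  omega

lemma ord_inv (f : X.functionField) (z : X) : Scheme.ord f⁻¹ z = - Scheme.ord f z := by
  by_cases hf : f = 0
  · rw [hf, inv_zero, Scheme.ord_zero]
    rfl
  · have := Scheme.ord_mul (x := z) hf (inv_ne_zero hf)
    rw [mul_inv_cancel₀ hf, ord_one] at this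
    omega

lemma ord_pow {f : X.functionField} (hf : f ≠ 0) (z : X) (n : ℕ) :
    Scheme.ord (f ^ n) z = n * Scheme.ord f z := by
  induction n with
  | zero => rw [pow_zero, ord_one, Nat.cast_zero, zero_mul]
  | succ n ih => rw [pow_succ, Scheme.ord_mul (pow_ne_zero n hf) hf, ih, Nat.cast_succ, add_one_mul]

lemma ord_div {f g : X.functionField} (hf : f ≠ 0) (hg : g ≠ 0) (z : X) :
    Scheme.ord (f / g) z = Scheme.ord f z - Scheme.ord g z := by
  rw [div_eq_mul_inv, Scheme.ord_mul hf (inv_ne_zero hg), ord_inv, sub_eq_add_neg]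

lemma exists_ringOrd_eq_and_ord_algebraMap_eq {z : X} (hz : Order.coheight z = 1)
    {r : X.presheaf.stalk z} (hr : r ≠ 0) :
    ∃ n : ℕ, Ring.ord (X.presheaf.stalk z) r = n ∧
      Scheme.ord (algebraMap (X.presheaf.stalk z) X.functionField r) z = n := by
  have : Ring.KrullDimLE 1 (X.presheaf.stalk z) := krullDimLE_of_coheight_le hz.le
  have hr0 := mem_nonZeroDivisors_of_ne_zero hr
  obtain ⟨n, hn⟩ := ENat.ne_top_iff_exists.mp (Ring.ord_ne_top hr0)
  have hr' : algebraMap (X.presheaf.stalk z) X.functionField r ≠ 0 := by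
    rwa [Ne, map_eq_zero_iff _ (algebraMap_stalk_injective z)]
  refine ⟨n, hn.symm, (Scheme.ord_eq_iff hz hr').mpr ((Ring.ordFrac_eq_ord _ hr).trans ?_)⟩
  exact Ring.ordMonoidWithZeroHom_eq_coe _ hr0 hn.symm

lemma ord_nonneg_of_mem_regularAt {z : X} {f : X.functionField} (hf : f ∈ regularAt z) :
    0 ≤ Scheme.ord f z := by
  by_cases hz : Order.coheight z = 1
  · obtain ⟨r, rfl⟩ := hf
    by_cases hr : r = 0
    · rw [hr, map_zero, Scheme.ord_zero]
      rfl
    · obtain ⟨n, -, hn⟩ := exists_ringOrd_eq_and_ord_algebraMap_eq hz hr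
      exact hn ▸ Int.natCast_nonneg n
  · rw [Scheme.ord_eq_zero_of_coheight_neq_one hz]

lemma ord_eq_zero_of_mem_regularAt_of_inv_mem {z : X} {f : X.functionField} (hf : f ∈ regularAt z)
    (hf' : f⁻¹ ∈ regularAt z) : Scheme.ord f z = 0 := by
  have h := ord_nonneg_of_mem_regularAt hf
  have h' := ord_nonneg_of_mem_regularAt hf'
  rw [ord_inv] at h'
  omega

lemma ord_pos_of_inv_notMem_regularAt {z : X} (hz : Order.coheight z = 1) {f : X.functionField}
    (hf : f ∈ regularAt z) (hf' : f⁻¹ ∉ regularAt z) : 0 < Scheme.ord f z := by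
  obtain ⟨r, rfl⟩ := hf
  have hr := ne_zero_of_map (ne_zero_of_inv_notMem_regularAt hf')
  rw [inv_algebraMap_mem_regularAt_iff hr] at hf'
  obtain ⟨n, hn, hn'⟩ := exists_ringOrd_eq_and_ord_algebraMap_eq hz hr
  rw [hn', Nat.cast_pos]
  refine Nat.pos_of_ne_zero ?_
  rintro rfl
  rw [Ring.ord, Nat.cast_zero, Module.length_eq_zero_iff,
    Submodule.Quotient.subsingleton_iff] at hn
  exact hf' (Ideal.span_singleton_eq_top.mp hn)

lemma ord_eq_one_of_forall_div_mem_regularAt {z : X} (hz : Order.coheight z = 1)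
    {f : X.functionField} (hf : f ∈ regularAt z) (hf' : f⁻¹ ∉ regularAt z)
    (h : ∀ s ∈ regularAt z, s⁻¹ ∉ regularAt z → s / f ∈ regularAt z) : Scheme.ord f z = 1 := by
  obtain ⟨r, rfl⟩ := hf
  have hr' := ne_zero_of_inv_notMem_regularAt hf'
  have hr := ne_zero_of_map hr'
  rw [inv_algebraMap_mem_regularAt_iff hr] at hf'
  obtain ⟨n, hn, hn'⟩ := exists_ringOrd_eq_and_ord_algebraMap_eq hz hr
  have hmax : Ideal.span {r} = IsLocalRing.maximalIdeal (X.presheaf.stalk z) := by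
    refine le_antisymm ((Ideal.span_singleton_le_iff_mem _).mpr hf') fun s hs => ?_
    by_cases hs0 : s = 0
    · rw [hs0]
      exact zero_mem _
    obtain ⟨t, ht⟩ := h _ ⟨s, rfl⟩ (mt (inv_algebraMap_mem_regularAt_iff hs0).mp hs)
    refine Ideal.mem_span_singleton'.mpr ⟨t, algebraMap_stalk_injective z ?_⟩
    rw [map_mul, ht, div_mul_cancel₀ _ hr']
  have hone : Ring.ord (X.presheaf.stalk z) r = 1 := by
    rw [Ring.ord, Module.length_eq_one_iff, isSimpleModule_iff_isCoatom, hmax]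
    exact (IsLocalRing.maximalIdeal.isMaximal _).out
  rw [hn', Nat.cast_eq_one]
  exact_mod_cast hn.symm.trans hone

lemma finite_ord_neg_of_isAffineOpen {U : X.Opens} (hU : IsAffineOpen U) (f : X.functionField) :
    {z | z ∈ U ∧ Scheme.ord f z < 0}.Finite := by
  rcases isEmpty_or_nonempty U with hempty | hne
  · exact Set.finite_empty.subset fun z hz => hempty.elim ⟨z, hz.1⟩
  have := functionField_isFractionRing_of_isAffineOpen X U hU
  have : IsNoetherianRing Γ(X, U) := IsLocallyNoetherian.component_noetherian ⟨U, hU⟩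
  obtain ⟨a, b, hb, hab⟩ := IsFractionRing.div_surjective (A := Γ(X, U)) f
  have hfin : {P : PrimeSpectrum Γ(X, U) | P.asIdeal ∈ (Ideal.span {b}).minimalPrimes}.Finite :=
    (Ideal.finite_minimalPrimes_of_isNoetherianRing _ _).preimage
      fun P _ Q _ h => PrimeSpectrum.ext h
  refine (hfin.image hU.fromSpec).subset ?_
  rintro z ⟨hz, hord⟩
  have hz1 : Order.coheight z = 1 := by
    by_contra h
    exact hord.ne (Scheme.ord_eq_zero_of_coheight_neq_one h f)
  have hbz : b ∈ (hU.primeIdealOf ⟨z, hz⟩).asIdeal := by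
    rw [mem_primeIdealOf_iff]
    intro hbz
    exact hord.not_ge (ord_nonneg_of_mem_regularAt
      ((mem_regularAt_iff_of_isAffineOpen hU hz).mpr ⟨a, b, hbz, hab.symm⟩))
  exact ⟨hU.primeIdealOf ⟨z, hz⟩, mem_minimalPrimes_span_singleton_of_height_le_one
    ((height_primeIdealOf hU _).trans hz1).le (nonZeroDivisors.ne_zero hb) hbz,
    hU.fromSpec_primeIdealOf ⟨z, hz⟩⟩

lemma finite_ord_ne_zero [CompactSpace X] (f : X.functionField) :
    {z : X | Scheme.ord f z ≠ 0}.Finite := by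
  have hneg (f : X.functionField) : {z : X | Scheme.ord f z < 0}.Finite := by
    obtain ⟨s, hs, htop⟩ := isCompact_iff_finite_and_eq_biUnion_affineOpens.mp
      (show IsCompact ((⊤ : X.Opens) : Set X) from isCompact_univ)
    refine (hs.biUnion fun U _ => finite_ord_neg_of_isAffineOpen U.2 f).subset fun z hz => ?_
    have hzU : z ∈ ⨆ i ∈ s, (i : X.Opens) := htop ▸ TopologicalSpace.Opens.mem_top z
    simp only [TopologicalSpace.Opens.mem_iSup] at hzU
    obtain ⟨U, hU, hzU⟩ := hzU
    exact Set.mem_biUnion hU ⟨hzU, hz⟩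
  refine ((hneg f).union (hneg f⁻¹)).subset fun z hz => ?_
  rcases lt_or_gt_of_ne hz with h | h
  · exact Or.inl h
  · refine Or.inr ?_
    rw [Set.mem_ofPred_eq, ord_inv]
    omega

end OrderOfVanishing

section Charts

lemma appIso_inv_comp_map {X Y Z : Scheme.{u}} (g : X ⟶ Y) (f : Y ⟶ Z) (h : X ⟶ Z)
    (e : g ≫ f = h) [IsOpenImmersion f] [IsOpenImmersion h] (hle : h ''ᵁ ⊤ ≤ f ''ᵁ ⊤) :
    (f.appIso ⊤).inv ≫ Z.presheaf.map (homOfLE hle).op = g.appTop ≫ (h.appIso ⊤).inv := by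
  subst e
  have hle' : (⊤ : X.Opens) ≤ g ⁻¹ᵁ ⊤ := le_rfl
  have htop : g.appTop = g.appLE ⊤ ⊤ hle' := Scheme.Hom.app_eq_appLE _
  rw [htop, ← cancel_mono ((g ≫ f).appIso ⊤).hom, Category.assoc, Category.assoc, Iso.inv_hom_id,
    Category.comp_id, Scheme.Hom.appIso_hom', Scheme.Hom.map_appLE, Iso.inv_comp_eq,
    Scheme.Hom.appIso_hom']
  exact (Scheme.Hom.appLE_comp_appLE _ _ _ _ _ _ _).symm

variable (k : Type u) [Field k] {N : Type u} [AddCommGroup N]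
  [Module.Finite ℤ N] (Δ : Fan N)

/-- The affine open subset `U_σ` of `X(Δ)`. -/
noncomputable abbrev chartOpen (σ : Δ.Cone) : (toricVariety k Δ).Opens := chart k Δ σ ''ᵁ ⊤

instance chartOpen_nonempty (σ : Δ.Cone) : Nonempty (chartOpen k Δ σ) :=
  chart_image_nonempty k Δ σ

lemma chartOpen_isAffineOpen (σ : Δ.Cone) : IsAffineOpen (chartOpen k Δ σ) :=
  (isAffineOpen_top _).image_of_isOpenImmersion _

/-- The identification of the ring `k[σ^∨ ∩ M]` with the regular functions on `U_σ`. -/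
noncomputable def chartSections (σ : Δ.Cone) :
    CommRingCat.of (ChartRing k σ.1) ≅ Γ(toricVariety k Δ, chartOpen k Δ σ) :=
  (Scheme.ΓSpecIso (.of (ChartRing k σ.1))).symm ≪≫ ((chart k Δ σ).appIso ⊤).symm

lemma chartToFunctionField_apply (σ : Δ.Cone) (a : ChartRing k σ.1) :
    chartToFunctionField k Δ σ a =
      (toricVariety k Δ).germToFunctionField (chartOpen k Δ σ) ((chartSections k Δ σ).hom a) :=
  rfl

variable {k Δ}

lemma mem_chartOpen {σ : Δ.Cone} {y : toricVariety k Δ} :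
    y ∈ chartOpen k Δ σ ↔ ∃ P : PrimeSpectrum (ChartRing k σ.1), chart k Δ σ P = y := by
  constructor
  · rintro ⟨P, -, h⟩
    exact ⟨P, h⟩
  · rintro ⟨P, h⟩
    exact ⟨P, trivial, h⟩

lemma chart_mem_chartOpen (σ : Δ.Cone) (P : PrimeSpectrum (ChartRing k σ.1)) :
    chart k Δ σ P ∈ chartOpen k Δ σ := mem_chartOpen.mpr ⟨P, rfl⟩

lemma chart_mem_basicOpen {σ : Δ.Cone} {P : PrimeSpectrum (ChartRing k σ.1)}
    {b : ChartRing k σ.1} :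
    chart k Δ σ P ∈ (toricVariety k Δ).basicOpen ((chartSections k Δ σ).hom b) ↔
      b ∉ P.asIdeal := by
  have h : (chartSections k Δ σ).hom b = ((chart k Δ σ).appIso ⊤).inv
    ((Scheme.ΓSpecIso (.of (ChartRing k σ.1))).inv b) := rfl
  rw [h, ← Scheme.image_basicOpen, basicOpen_eq_of_affine]
  constructor
  · rintro ⟨Q, hQ, hPQ⟩
    rw [(chart k Δ σ).isOpenEmbedding.injective hPQ] at hQ
    exact hQ
  · intro hP
    exact ⟨P, hP, rfl⟩

lemma chartSections_surjective (σ : Δ.Cone) :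
    Function.Surjective (chartSections k Δ σ).hom :=
  (ConcreteCategory.bijective_of_isIso (chartSections k Δ σ).hom).2

lemma chartSections_injective (σ : Δ.Cone) :
    Function.Injective (chartSections k Δ σ).hom :=
  (ConcreteCategory.bijective_of_isIso (chartSections k Δ σ).hom).1

lemma chartToFunctionField_injective (σ : Δ.Cone) :
    Function.Injective (chartToFunctionField k Δ σ) := fun _ _ h =>
  chartSections_injective σ (Scheme.germToFunctionField_injective _ _ h)

lemma chartToFunctionField_ne_zero {σ : Δ.Cone} {a : ChartRing k σ.1} (ha : a ≠ 0) :
    chartToFunctionField k Δ σ a ≠ 0 := by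
  rwa [Ne, map_eq_zero_iff _ (chartToFunctionField_injective σ)]

lemma chartToFunctionField_mem_regularAt {σ : Δ.Cone} {y : toricVariety k Δ}
    (hy : y ∈ chartOpen k Δ σ) (a : ChartRing k σ.1) :
    chartToFunctionField k Δ σ a ∈ regularAt y :=
  germToFunctionField_mem_regularAt hy _

lemma inv_chartToFunctionField_mem_regularAt_iff {σ : Δ.Cone} {P : PrimeSpectrum (ChartRing k σ.1)}
    {b : ChartRing k σ.1} (hb : b ≠ 0) :
    (chartToFunctionField k Δ σ b)⁻¹ ∈ regularAt (chart k Δ σ P) ↔ b ∉ P.asIdeal := by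
  rw [← chart_mem_basicOpen, ← inv_germToFunctionField_mem_regularAt_iff (chart_mem_chartOpen σ P),
    chartToFunctionField_apply]
  rwa [Ne, map_eq_zero_iff _ (chartSections_injective σ)]

lemma mem_regularAt_chart {σ : Δ.Cone} {P : PrimeSpectrum (ChartRing k σ.1)}
    {f : (toricVariety k Δ).functionField} :
    f ∈ regularAt (chart k Δ σ P) ↔ ∃ a b : ChartRing k σ.1, b ∉ P.asIdeal ∧
      f = chartToFunctionField k Δ σ a / chartToFunctionField k Δ σ b := by
  rw [mem_regularAt_iff_of_isAffineOpen (chartOpen_isAffineOpen k Δ σ) (chart_mem_chartOpen σ P)]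
  constructor
  · rintro ⟨a, b, hb, rfl⟩
    obtain ⟨a, rfl⟩ := chartSections_surjective σ a
    obtain ⟨b, rfl⟩ := chartSections_surjective σ b
    exact ⟨a, b, chart_mem_basicOpen.mp hb, rfl⟩
  · rintro ⟨a, b, hb, rfl⟩
    exact ⟨_, _, chart_mem_basicOpen.mpr hb, rfl⟩

lemma exists_chartToFunctionField_eq {σ : Δ.Cone} {f : (toricVariety k Δ).functionField}
    (hf : ∀ y ∈ chartOpen k Δ σ, f ∈ regularAt y) : ∃ a, chartToFunctionField k Δ σ a = f := by
  obtain ⟨a, ha⟩ := exists_germToFunctionField_eq_of_forall_mem_regularAt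
    (chartOpen_isAffineOpen k Δ σ) hf
  obtain ⟨a, rfl⟩ := chartSections_surjective σ a
  exact ⟨a, ha⟩

lemma chart_comp {τ σ : Δ.Cone} (h : τ ≤ σ) (P : PrimeSpectrum (ChartRing k τ.1)) :
    chart k Δ σ (P.comap (chartMap k h)) = chart k Δ τ P := by
  rw [← chartMap_chart k Δ h]
  rfl

lemma chartOpen_mono {τ σ : Δ.Cone} (h : τ ≤ σ) : chartOpen k Δ τ ≤ chartOpen k Δ σ := by
  intro y hy
  obtain ⟨P, rfl⟩ := mem_chartOpen.mp hy
  rw [← chart_comp h]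
  exact chart_mem_chartOpen σ _

lemma chartToFunctionField_chartMap {τ σ : Δ.Cone} (h : τ ≤ σ) (a : ChartRing k σ.1) :
    chartToFunctionField k Δ τ (chartMap k h a) = chartToFunctionField k Δ σ a := by
  have key : (toricVariety k Δ).presheaf.map (homOfLE (chartOpen_mono (k := k) h)).op
      ((chartSections k Δ σ).hom a) = (chartSections k Δ τ).hom (chartMap k h a) := by
    have h1 : (chartSections k Δ σ).hom ≫ (toricVariety k Δ).presheaf.map
        (homOfLE (chartOpen_mono (k := k) h)).op =
        CommRingCat.ofHom (chartMap k h) ≫ (chartSections k Δ τ).hom := by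
      simp only [chartSections, Iso.trans_hom, Iso.symm_hom, Category.assoc]
      rw [appIso_inv_comp_map _ _ _ (chartMap_chart k Δ h),
        Scheme.ΓSpecIso_inv_naturality_assoc]
    exact congrArg (fun f => f.hom a) h1
  rw [chartToFunctionField_apply, chartToFunctionField_apply, ← key]
  exact TopCat.Presheaf.germ_res_apply (toricVariety k Δ).presheaf
    (homOfLE (chartOpen_mono (k := k) h)) _ _ _

lemma coheight_chart (σ : Δ.Cone) (P : PrimeSpectrum (ChartRing k σ.1)) :
    Order.coheight (chart k Δ σ P) = P.asIdeal.height := by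
  rw [idealHeight_eq_coheight (.of (ChartRing k σ.1)) P]
  exact coheight_eq_of_isOpenImmersion (chart k Δ σ)

lemma specializes_chart {σ : Δ.Cone} {P Q : PrimeSpectrum (ChartRing k σ.1)} :
    chart k Δ σ P ⤳ chart k Δ σ Q ↔ P ≤ Q := by
  rw [PrimeSpectrum.le_iff_specializes]
  exact (chart k Δ σ).isOpenEmbedding.isInducing.specializes_iff

end Charts

section MonoidAlgebra

variable {k : Type*} [Semiring k] {M : Type*}

lemma eq_of_mem_support_coeff_single {u w : M} {c : k}
    (h : w ∈ (AddMonoidAlgebra.single u c).coeff.support) : w = u := by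
  rw [AddMonoidAlgebra.coeff_single] at h
  exact Finset.mem_singleton.mp (Finsupp.support_single_subset h)

lemma mem_of_forall_single_mem [AddMonoid M] {a : AddMonoidAlgebra k M}
    {I : Ideal (AddMonoidAlgebra k M)} (h : ∀ u ∈ a.coeff.support, .single u 1 ∈ I) : a ∈ I := by
  rw [← AddMonoidAlgebra.sum_coeff_single a]
  refine Ideal.sum_mem _ fun u hu => ?_
  rw [← zero_add u, ← mul_one (a.coeff _), ← AddMonoidAlgebra.single_mul_single, zero_add]
  exact I.mul_mem_left _ (h u hu)

lemma mem_support_coeff_mapDomainRingHom {M' : Type*} [AddMonoid M] [AddMonoid M'] {f : M →+ M'}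
    {a : AddMonoidAlgebra k M} {u : M'}
    (hu : u ∈ (AddMonoidAlgebra.mapDomainRingHom k f a).coeff.support) :
    ∃ w ∈ a.coeff.support, f w = u := by
  classical
  exact Finset.mem_image.mp (Finsupp.mapDomain_support hu)

lemma exists_eq_single_mul_mapDomainRingHom {M' : Type*} [AddMonoid M] [AddMonoid M']
    (f : M' →+ M) (m : M) {p : AddMonoidAlgebra k M}
    (hp : ∀ u ∈ p.coeff.support, ∃ w, u = m + f w) :
    ∃ q, p = .single m 1 * AddMonoidAlgebra.mapDomainRingHom k f q := by
  choose! w hw using hp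
  refine ⟨∑ u ∈ p.coeff.support, .single (w u) (p.coeff u), ?_⟩
  rw [map_sum, Finset.mul_sum]
  conv_lhs => rw [← AddMonoidAlgebra.sum_coeff_single p]
  refine Finset.sum_congr rfl fun u hu => ?_
  rw [AddMonoidAlgebra.mapDomainRingHom_apply, AddMonoidAlgebra.mapDomain_single,
    AddMonoidAlgebra.single_mul_single, one_mul, ← hw u hu]

end MonoidAlgebra

section Characters

variable (k : Type u) [Field k] {N : Type u} [AddCommGroup N] [Module.Finite ℤ N] (Δ : Fan N)

/-- The character `x^u` as a rational function on `X(Δ)`. -/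
noncomputable def character (u : Module.Dual ℤ N) : (toricVariety k Δ).functionField :=
  chartToFunctionField k Δ Δ.zeroCone (.single ⟨u, Δ.mem_dualMonoid_zeroCone u⟩ 1)

variable {k Δ}

lemma character_ne_zero (u : Module.Dual ℤ N) : character k Δ u ≠ 0 :=
  chartToFunctionField_ne_zero (AddMonoidAlgebra.single_ne_zero.mpr one_ne_zero)

lemma character_add (u v : Module.Dual ℤ N) :
    character k Δ (u + v) = character k Δ u * character k Δ v := by
  rw [character, character, character, ← map_mul, AddMonoidAlgebra.single_mul_single, one_mul]
  rfl

lemma character_zero : character k Δ 0 = 1 := by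
  have := character_add (k := k) (Δ := Δ) 0 0
  rw [add_zero] at this
  exact (mul_eq_left₀ (character_ne_zero 0)).mp this.symm

lemma character_neg (u : Module.Dual ℤ N) : character k Δ (-u) = (character k Δ u)⁻¹ := by
  refine eq_inv_of_mul_eq_one_left ?_
  rw [← character_add, neg_add_cancel, character_zero]

lemma chartToFunctionField_single {σ : Δ.Cone} (u : dualMonoid σ.1) :
    chartToFunctionField k Δ σ (.single u 1) = character k Δ u.1 := by
  rw [← chartToFunctionField_chartMap (Δ.zeroCone_le σ), chartMap_single]
  rfl

lemma character_mem_regularAt {σ : Δ.Cone} {y : toricVariety k Δ} (hy : y ∈ chartOpen k Δ σ)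
    {u : Module.Dual ℤ N} (hu : u ∈ dualMonoid σ.1) : character k Δ u ∈ regularAt y := by
  rw [← chartToFunctionField_single (σ := σ) ⟨u, hu⟩]
  exact chartToFunctionField_mem_regularAt hy _

lemma inv_character_mem_regularAt {σ : Δ.Cone} {y : toricVariety k Δ} (hy : y ∈ chartOpen k Δ σ)
    {u : Module.Dual ℤ N} (hu : -u ∈ dualMonoid σ.1) : (character k Δ u)⁻¹ ∈ regularAt y := by
  rw [← character_neg]
  exact character_mem_regularAt hy hu

variable [Module.Free ℤ N]

lemma ord_character_of_mem_torus {y : toricVariety k Δ} (hy : y ∈ chartOpen k Δ Δ.zeroCone)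
    (u : Module.Dual ℤ N) : Scheme.ord (character k Δ u) y = 0 :=
  ord_eq_zero_of_mem_regularAt_of_inv_mem
    (character_mem_regularAt hy (Δ.mem_dualMonoid_zeroCone u))
    (inv_character_mem_regularAt hy (Δ.mem_dualMonoid_zeroCone _))

/-- The order of vanishing at `y` of the characters, as a homomorphism. -/
noncomputable def ordCharacter (y : toricVariety k Δ) : Module.Dual ℤ N →+ ℤ where
  toFun u := Scheme.ord (character k Δ u) y
  map_zero' := by rw [character_zero, ord_one]
  map_add' u v := by
    rw [character_add, Scheme.ord_mul (character_ne_zero u) (character_ne_zero v)]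

end Characters

section DivisorPoint

variable {k : Type u} [Field k] {N : Type u} [AddCommGroup N] {Δ : Fan N}

lemma mem_dualMonoid_rayCone {v : Δ.Ray} {u : Module.Dual ℤ N} :
    u ∈ dualMonoid (Δ.rayCone v).1 ↔ 0 ≤ u v.1 := by
  refine ⟨fun h => nonneg_of_mem_rayCone Δ v ⟨u, h⟩, fun h => ?_⟩
  have := mem_dualMonoid_hull (s := {v.1}) (u := u)
  rw [Set.image_singleton] at this
  exact this.mpr fun w hw => (Set.mem_singleton_iff.mp hw).symm ▸ h

lemma rayCone_le_iff {v : Δ.Ray} {σ : Δ.Cone} : Δ.rayCone v ≤ σ ↔ latticeVec v.1 ∈ σ.1 :=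
  Submodule.span_singleton_le_iff_mem _ _

lemma mem_rayIdeal {v : Δ.Ray} {a : ChartRing k (Δ.rayCone v).1} :
    a ∈ rayIdeal k Δ v ↔ ∀ u ∈ a.coeff.support, 0 < u.1 v.1 := by
  have h : rayIdeal k Δ v = Ideal.span (AddMonoidAlgebra.of' k _ ''
      {u : dualMonoid (Δ.rayCone v).1 | 0 < u.1 v.1}) :=
    congrArg Ideal.span (Set.ext fun x => exists_congr fun u => and_congr_right fun _ => eq_comm)
  rw [h, AddMonoidAlgebra.mem_ideal_span_of'_image]
  refine forall₂_congr fun u _ => ⟨?_, fun hu => ⟨u, hu, 0, (zero_add _).symm⟩⟩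
  rintro ⟨u', hu', d, rfl⟩
  exact add_pos_of_nonneg_of_pos (nonneg_of_mem_rayCone Δ v d) hu'

lemma rayIdeal_eq_span_singleton {v : Δ.Ray} {u₁ : dualMonoid (Δ.rayCone v).1}
    (hu₁ : u₁.1 v.1 = 1) : rayIdeal k Δ v = Ideal.span {.single u₁ 1} := by
  refine le_antisymm (Ideal.span_le.mpr ?_) ((Ideal.span_singleton_le_iff_mem _).mpr
    (Ideal.subset_span ⟨u₁, by rw [hu₁]; exact one_pos, rfl⟩))
  rintro _ ⟨u, hu, rfl⟩
  refine Ideal.mem_span_singleton.mpr ⟨.single ⟨u.1 - u₁.1, mem_dualMonoid_rayCone.mpr ?_⟩ 1, ?_⟩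
  · rw [LinearMap.sub_apply, hu₁]
    omega
  · rw [AddMonoidAlgebra.single_mul_single, one_mul]
    exact congrArg (AddMonoidAlgebra.single · 1) (Subtype.ext (add_sub_cancel _ _).symm)

variable [Module.Finite ℤ N]

lemma divisorPoint_mem_chartOpen (v : Δ.Ray) :
    divisorPoint k Δ v ∈ chartOpen k Δ (Δ.rayCone v) := chart_mem_chartOpen _ _

variable [Module.Free ℤ N]

lemma exists_mem_dualMonoid_rayCone_eq_one (v : Δ.Ray) :
    ∃ u₁ : dualMonoid (Δ.rayCone v).1, u₁.1 v.1 = 1 := by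
  obtain ⟨u₁, hu₁⟩ := v.2.1.exists_dual
  exact ⟨⟨u₁, mem_dualMonoid_rayCone.mpr (by rw [hu₁]; exact zero_le_one)⟩, hu₁⟩

lemma isNoetherianRing_chartRing (σ : Δ.Cone) : IsNoetherianRing (ChartRing k σ.1) := by
  have : AddMonoid.FG (dualMonoid σ.1) :=
    (AddMonoid.fg_iff_addSubmonoid_fg _).mpr (dualMonoid_fg (Δ.rational _ σ.2))
  exact Algebra.FiniteType.isNoetherianRing k _

lemma coheight_divisorPoint (v : Δ.Ray) : Order.coheight (divisorPoint k Δ v) = 1 := by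
  obtain ⟨u₁, hu₁⟩ := exists_mem_dualMonoid_rayCone_eq_one v
  have hspan := rayIdeal_eq_span_singleton (k := k) hu₁
  have := isNoetherianRing_chartRing (k := k) (Δ.rayCone v)
  have : (rayIdeal k Δ v).IsPrincipal := ⟨_, hspan⟩
  refine (coheight_chart _ _).trans (le_antisymm ?_ ?_)
  · refine Ideal.height_le_one_of_isPrincipal_of_mem_minimalPrimes (rayIdeal k Δ v) _ ?_
    rw [Ideal.minimalPrimes_eq_subsingleton_self]
    exact Set.mem_singleton _
  · rw [Order.one_le_iff_ne_zero, Ne, Ideal.height_eq_zero_iff,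
      IsDomain.minimalPrimes_eq_singleton_bot, Set.mem_singleton_iff]
    exact fun h => AddMonoidAlgebra.single_ne_zero.mpr one_ne_zero
      (Ideal.span_singleton_eq_bot.mp (hspan.symm.trans h))

lemma ord_character_of_eq_one {v : Δ.Ray} {u₁ : dualMonoid (Δ.rayCone v).1}
    (hu₁ : u₁.1 v.1 = 1) : Scheme.ord (character k Δ u₁.1) (divisorPoint k Δ v) = 1 := by
  have hspan := rayIdeal_eq_span_singleton (k := k) hu₁
  rw [← chartToFunctionField_single]
  refine ord_eq_one_of_forall_div_mem_regularAt (coheight_divisorPoint v)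
    (chartToFunctionField_mem_regularAt (divisorPoint_mem_chartOpen v) _)
    (fun h => (inv_chartToFunctionField_mem_regularAt_iff
      (AddMonoidAlgebra.single_ne_zero.mpr one_ne_zero)).mp h
      (hspan.ge (Ideal.mem_span_singleton_self _))) fun s hs hs' => ?_
  obtain ⟨a, b, hb, rfl⟩ := mem_regularAt_chart.mp hs
  have ha : a ∈ rayIdeal k Δ v := by
    by_contra ha
    rw [inv_div] at hs'
    exact hs' (mem_regularAt_chart.mpr ⟨b, a, ha, rfl⟩)
  rw [hspan] at ha
  obtain ⟨c, rfl⟩ := Ideal.mem_span_singleton.mp ha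
  refine mem_regularAt_chart.mpr ⟨c, b, hb, ?_⟩
  rw [map_mul, div_right_comm, mul_div_cancel_left₀ _
    (chartToFunctionField_ne_zero (AddMonoidAlgebra.single_ne_zero.mpr one_ne_zero))]

lemma ord_character (v : Δ.Ray) (u : Module.Dual ℤ N) :
    Scheme.ord (character k Δ u) (divisorPoint k Δ v) = u v.1 := by
  obtain ⟨u₁, hu₁⟩ := exists_mem_dualMonoid_rayCone_eq_one v
  have h1 : ordCharacter (divisorPoint k Δ v) u₁.1 = 1 := ord_character_of_eq_one hu₁
  have hv : (u - u v.1 • u₁.1) v.1 = 0 := by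
    rw [LinearMap.sub_apply, LinearMap.smul_apply, hu₁, smul_eq_mul, mul_one, sub_self]
  have h0 : ordCharacter (divisorPoint k Δ v) (u - u v.1 • u₁.1) = 0 :=
    ord_eq_zero_of_mem_regularAt_of_inv_mem
      (character_mem_regularAt (divisorPoint_mem_chartOpen v) (mem_dualMonoid_rayCone.mpr hv.ge))
      (inv_character_mem_regularAt (divisorPoint_mem_chartOpen v)
        (mem_dualMonoid_rayCone.mpr (by rw [LinearMap.neg_apply, hv, neg_zero])))
  rw [map_sub, map_zsmul, h1, smul_eq_mul, mul_one, sub_eq_zero] at h0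
  exact h0

lemma ord_divisorPoint_of_forall_le {v : Δ.Ray} {p : ChartRing k Δ.zeroCone.1}
    {u₀ : dualMonoid Δ.zeroCone.1} (hu₀ : u₀ ∈ p.coeff.support)
    (hmin : ∀ u ∈ p.coeff.support, u₀.1 v.1 ≤ u.1 v.1) :
    Scheme.ord (chartToFunctionField k Δ Δ.zeroCone p) (divisorPoint k Δ v) = u₀.1 v.1 := by
  classical
  have hle := Δ.zeroCone_le (Δ.rayCone v)
  obtain ⟨q, rfl⟩ := exists_eq_single_mul_mapDomainRingHom
    (AddSubmonoid.inclusion (dualMonoid_anti hle)) u₀ (p := p)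
    fun u hu => ⟨⟨u.1 - u₀.1, mem_dualMonoid_rayCone.mpr (sub_nonneg.mpr (hmin u hu))⟩,
      Subtype.ext (add_sub_cancel u₀.1 u.1).symm⟩
  have hq : q ∉ rayIdeal k Δ v := fun hq => by
    obtain ⟨t, ht, htu⟩ := Finset.mem_image.mp
      (AddMonoidAlgebra.support_coeff_single_mul_subset _ _ _ hu₀)
    obtain ⟨w, hw, rfl⟩ := mem_support_coeff_mapDomainRingHom ht
    have hwv := congrArg (fun u => u.1 v.1) htu
    have := mem_rayIdeal.mp hq w hw
    change u₀.1 v.1 + w.1 v.1 = u₀.1 v.1 at hwv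
    omega
  have hq0 : q ≠ 0 := fun h => hq (h ▸ zero_mem _)
  have hordq := ord_eq_zero_of_mem_regularAt_of_inv_mem
    (chartToFunctionField_mem_regularAt (divisorPoint_mem_chartOpen v) q)
    ((inv_chartToFunctionField_mem_regularAt_iff hq0).mpr hq)
  rw [map_mul, chartToFunctionField_single, Scheme.ord_mul (character_ne_zero _) ?_,
    ord_character]
  · exact (congrArg _ ((congrArg (Scheme.ord · _)
      (chartToFunctionField_chartMap hle q)).trans hordq)).trans (add_zero _)
  · exact (chartToFunctionField_chartMap hle q).trans_ne (chartToFunctionField_ne_zero hq0)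

lemma ord_single_divisorPoint (v : Δ.Ray) (u : dualMonoid Δ.zeroCone.1) {c : k} (hc : c ≠ 0) :
    Scheme.ord (chartToFunctionField k Δ Δ.zeroCone (.single u c)) (divisorPoint k Δ v) =
      u.1 v.1 := by
  refine ord_divisorPoint_of_forall_le ?_ fun w hw => (eq_of_mem_support_coeff_single hw) ▸ le_rfl
  rw [AddMonoidAlgebra.coeff_single, Finsupp.support_single _ hc]
  exact Finset.mem_singleton_self u

lemma le_of_le_ord_divisorPoint {v : Δ.Ray} {p : ChartRing k Δ.zeroCone.1} {m : ℤ}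
    (hm : m ≤ Scheme.ord (chartToFunctionField k Δ Δ.zeroCone p) (divisorPoint k Δ v))
    {u : dualMonoid Δ.zeroCone.1} (hu : u ∈ p.coeff.support) : m ≤ u.1 v.1 := by
  obtain ⟨u₀, hu₀, hmin⟩ := p.coeff.support.exists_min_image (fun u => u.1 v.1) ⟨u, hu⟩
  rw [ord_divisorPoint_of_forall_le hu₀ hmin] at hm
  exact hm.trans (hmin u hu)

lemma divisorPoint_injective : Function.Injective (divisorPoint k Δ) := fun v w h =>
  Subtype.ext (eq_of_forall_dual_eq fun u => by
    rw [← ord_character (k := k) v u, h, ord_character])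

lemma divisorPoint_notMem_torus (v : Δ.Ray) : divisorPoint k Δ v ∉ chartOpen k Δ Δ.zeroCone := by
  intro h
  obtain ⟨u₁, hu₁⟩ := v.2.1.exists_dual
  have := ord_character_of_mem_torus h u₁
  rw [ord_character, hu₁] at this
  exact one_ne_zero this

open Classical in
lemma toricDivisor_apply (a : Δ.Ray → ℤ) (z : toricVariety k Δ) :
    toricDivisor k Δ a z = ∑ v, if z = divisorPoint k Δ v then a v else 0 := by
  simp only [toricDivisor, Function.locallyFinsuppWithin.coe_sum, Finset.sum_apply,
    Function.locallyFinsuppWithin.single_apply]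

lemma toricDivisor_divisorPoint (a : Δ.Ray → ℤ) (v : Δ.Ray) :
    toricDivisor k Δ a (divisorPoint k Δ v) = a v := by
  classical
  rw [toricDivisor_apply, Finset.sum_eq_single v]
  · rw [if_pos rfl]
  · exact fun w _ hw => if_neg fun h => hw (divisorPoint_injective h).symm
  · exact fun h => absurd (Finset.mem_univ v) h

lemma toricDivisor_of_mem_torus (a : Δ.Ray → ℤ) {z : toricVariety k Δ}
    (hz : z ∈ chartOpen k Δ Δ.zeroCone) : toricDivisor k Δ a z = 0 := by
  classical
  rw [toricDivisor_apply]
  refine Finset.sum_eq_zero fun v _ => if_neg ?_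
  rintro rfl
  exact divisorPoint_notMem_torus v hz

end DivisorPoint

section Points

variable {k : Type u} [Field k] {N : Type u} [AddCommGroup N] {Δ : Fan N}

/-- The prime ideal of `Y(v)` in the chart `U_σ`, for a ray `v` of `σ`. -/
noncomputable def rayPrime {v : Δ.Ray} {σ : Δ.Cone} (h : latticeVec v.1 ∈ σ.1) :
    PrimeSpectrum (ChartRing k σ.1) :=
  PrimeSpectrum.comap (chartMap k (rayCone_le_iff.mpr h)) ⟨rayIdeal k Δ v, inferInstance⟩

lemma single_mem_rayPrime {v : Δ.Ray} {σ : Δ.Cone} (h : latticeVec v.1 ∈ σ.1) {u : dualMonoid σ.1}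
    (hu : 0 < u.1 v.1) : .single u 1 ∈ (rayPrime (k := k) h).asIdeal := by
  change chartMap k (rayCone_le_iff.mpr h) (.single u 1) ∈ rayIdeal k Δ v
  rw [chartMap_single]
  exact Ideal.subset_span ⟨_, hu, rfl⟩

lemma rayPrime_le_iff {v : Δ.Ray} {σ : Δ.Cone} (h : latticeVec v.1 ∈ σ.1)
    {I : Ideal (ChartRing k σ.1)} :
    (rayPrime h).asIdeal ≤ I ↔ ∀ u : dualMonoid σ.1, 0 < u.1 v.1 → .single u 1 ∈ I := by
  classical
  refine ⟨fun hI u hu => hI (single_mem_rayPrime h hu),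
    fun hI a ha => mem_of_forall_single_mem fun u hu => hI u ?_⟩
  refine mem_rayIdeal.mp (show chartMap k (rayCone_le_iff.mpr h) a ∈ rayIdeal k Δ v from ha)
    (AddSubmonoid.inclusion (dualMonoid_anti (rayCone_le_iff.mpr h)) u) ?_
  refine (Finsupp.mapDomain_support_of_injective (AddSubmonoid.inclusion_injective _)
    a.coeff).symm ▸ Finset.mem_image_of_mem _ hu

variable [Module.Finite ℤ N]

lemma chart_rayPrime {v : Δ.Ray} {σ : Δ.Cone} (h : latticeVec v.1 ∈ σ.1) :
    chart k Δ σ (rayPrime h) = divisorPoint k Δ v :=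
  chart_comp _ _

variable [Module.Free ℤ N]

lemma Fan.faceCone_eq_bot (Δ : Fan N) {σ : PointedCone ℝ (ℝ ⊗[ℤ] N)} (hσ : σ ∈ Δ.cones)
    {m : Module.Dual ℤ N} (hm : m ∈ dualMonoid σ)
    (hpos : ∀ v : Δ.Ray, latticeVec v.1 ∈ σ → 0 < m v.1) : faceCone σ m = ⊥ := by
  by_contra h
  obtain ⟨v, hv⟩ := Δ.exists_ray_mem (Δ.face_mem _ hσ _ (isFace_faceCone hm)) h
  rw [latticeVec_mem_faceCone] at hv
  exact (hpos v hv.1).ne' hv.2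

lemma chart_mem_torus {σ : Δ.Cone} {P : PrimeSpectrum (ChartRing k σ.1)} {m : dualMonoid σ.1}
    (hm : ∀ v : Δ.Ray, latticeVec v.1 ∈ σ.1 → 0 < m.1 v.1) (hP : .single m 1 ∉ P.asIdeal) :
    chart k Δ σ P ∈ chartOpen k Δ Δ.zeroCone := by
  have hrange := chartDiagram_range k Δ (homOfLE (Δ.zeroCone_le σ)) m fun x =>
    (SetLike.ext_iff.mp (Δ.faceCone_eq_bot σ.2 m.2 hm) x).symm
  obtain ⟨Q, rfl⟩ := hrange.ge hP
  exact mem_chartOpen.mpr ⟨Q, (chart_comp (Δ.zeroCone_le σ) Q).symm⟩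

lemma chart_eq_divisorPoint {σ : Δ.Cone} {P : PrimeSpectrum (ChartRing k σ.1)}
    (hP : P.asIdeal.height = 1) {v : Δ.Ray} (hv : latticeVec v.1 ∈ σ.1)
    (hvP : ∀ u : dualMonoid σ.1, 0 < u.1 v.1 → .single u 1 ∈ P.asIdeal) :
    chart k Δ σ P = divisorPoint k Δ v := by
  obtain ⟨u, hu, hpos⟩ := Δ.exists_forall_pos σ.2
  have huv : 0 < u v.1 := hpos _ hv v.2.1.ne_zero
  have hmin := mem_minimalPrimes_span_singleton_of_height_le_one hP.le
    (AddMonoidAlgebra.single_ne_zero.mpr one_ne_zero) (hvP ⟨u, hu⟩ huv)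
  have hle := (rayPrime_le_iff hv).mpr hvP
  rw [← chart_rayPrime hv]
  refine congrArg _ (PrimeSpectrum.ext (le_antisymm ?_ hle))
  exact hmin.2 ⟨inferInstance,
    (Ideal.span_singleton_le_iff_mem _).mpr (single_mem_rayPrime hv huv)⟩ hle

lemma mem_torus_or_eq_divisorPoint {σ : Δ.Cone} {z : toricVariety k Δ}
    (hz : z ∈ chartOpen k Δ σ) (hz1 : Order.coheight z = 1) :
    z ∈ chartOpen k Δ Δ.zeroCone ∨
      ∃ v : Δ.Ray, latticeVec v.1 ∈ σ.1 ∧ z = divisorPoint k Δ v := by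
  classical
  obtain ⟨P, rfl⟩ := mem_chartOpen.mp hz
  rw [coheight_chart] at hz1
  by_cases! h : ∃ v : Δ.Ray, latticeVec v.1 ∈ σ.1 ∧
      ∀ u : dualMonoid σ.1, 0 < u.1 v.1 → .single u 1 ∈ P.asIdeal
  · obtain ⟨v, hv, hvP⟩ := h
    exact Or.inr ⟨v, hv, chart_eq_divisorPoint hz1 hv hvP⟩
  choose! u hu huP using h
  let S : Finset Δ.Ray := Finset.univ.filter fun v => latticeVec v.1 ∈ σ.1
  refine Or.inl (chart_mem_torus (m := ∑ v ∈ S, u v) (fun v hv => ?_) ?_)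
  · have hvS : v ∈ S := Finset.mem_filter.mpr ⟨Finset.mem_univ _, hv⟩
    rw [AddSubmonoid.coe_finsetSum, LinearMap.sum_apply]
    exact Finset.sum_pos' (fun w _ => nonneg_of_mem_dualMonoid (u w).2 hv) ⟨v, hvS, hu v hv⟩
  · have hprod : AddMonoidAlgebra.single (∑ v ∈ S, u v) (1 : k) = ∏ v ∈ S, .single (u v) 1 :=
      map_prod (AddMonoidAlgebra.of k (dualMonoid σ.1)) (fun v => Multiplicative.ofAdd (u v)) S
    rw [hprod, P.2.prod_mem_iff]
    rintro ⟨v, hv, hvP⟩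
    exact huP v (Finset.mem_filter.mp hv).2 hvP

lemma mem_torus_or_exists_eq_divisorPoint {z : toricVariety k Δ} (hz : Order.coheight z = 1) :
    z ∈ chartOpen k Δ Δ.zeroCone ∨ ∃ v : Δ.Ray, z = divisorPoint k Δ v := by
  obtain ⟨σ, y, hy⟩ := exists_chart k Δ z
  exact (mem_torus_or_eq_divisorPoint (mem_chartOpen.mpr ⟨y, hy⟩) hz).imp_right
    fun ⟨v, _, hv⟩ => ⟨v, hv⟩

lemma divisorPoint_mem_chartOpen_iff {v : Δ.Ray} {σ : Δ.Cone} :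
    divisorPoint k Δ v ∈ chartOpen k Δ σ ↔ latticeVec v.1 ∈ σ.1 := by
  refine ⟨fun h => ?_,
    fun h => chartOpen_mono (rayCone_le_iff.mpr h) (divisorPoint_mem_chartOpen v)⟩
  rcases mem_torus_or_eq_divisorPoint h (coheight_divisorPoint v) with h | ⟨w, hw, h⟩
  · exact absurd h (divisorPoint_notMem_torus v)
  · rwa [divisorPoint_injective h]

variable (k) in
lemma exists_point_forall_divisorPoint_specializes_iff (σ : Δ.Cone) :
    ∃ x ∈ chartOpen k Δ σ, ∀ v : Δ.Ray, divisorPoint k Δ v ⤳ x ↔ latticeVec v.1 ∈ σ.1 := by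
  let I : Ideal (ChartRing k σ.1) := Ideal.span (AddMonoidAlgebra.of' k _ ''
    {u | ∃ v : Δ.Ray, latticeVec v.1 ∈ σ.1 ∧ 0 < u.1 v.1})
  have hI : I ≠ ⊤ := by
    rw [Ideal.ne_top_iff_one, AddMonoidAlgebra.mem_ideal_span_of'_image]
    intro h
    obtain ⟨u, ⟨v, hv, huv⟩, d, hd⟩ := h 0 (by
      rw [AddMonoidAlgebra.one_def, AddMonoidAlgebra.coeff_single,
        Finsupp.support_single _ one_ne_zero]
      exact Finset.mem_singleton_self 0)
    have h0 : 0 = d.1 v.1 + u.1 v.1 := congrArg (fun u => u.1 v.1) hd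
    have := nonneg_of_mem_dualMonoid d.2 hv
    omega
  obtain ⟨m, hm, hIm⟩ := Ideal.exists_le_maximal I hI
  let P : PrimeSpectrum (ChartRing k σ.1) := ⟨m, hm.isPrime⟩
  refine ⟨chart k Δ σ P, chart_mem_chartOpen σ P, fun v => ⟨fun h => ?_, fun hv => ?_⟩⟩
  · exact divisorPoint_mem_chartOpen_iff.mp
      (h.mem_open (chartOpen k Δ σ).isOpen (chart_mem_chartOpen σ P))
  · rw [← chart_rayPrime hv, specializes_chart]
    exact (rayPrime_le_iff hv).mpr fun u hu => hIm (Ideal.subset_span ⟨u, ⟨v, hv, hu⟩, rfl⟩)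

end Points

section WeilDivisors

variable {X : Scheme.{u}}

lemma exists_opens_mem_iff_forall_not_specializes {S : Set X} (hS : S.Finite) :
    ∃ U : X.Opens, ∀ x, x ∈ U ↔ ∀ z ∈ S, ¬ z ⤳ x := by
  refine ⟨⟨(⋃ z ∈ S, closure {z})ᶜ,
    (hS.isClosed_biUnion fun z _ => isClosed_closure).isOpen_compl⟩, fun x => ?_⟩
  change x ∉ ⋃ z ∈ S, closure {z} ↔ _
  simp only [Set.mem_iUnion, not_exists, specializes_iff_mem_closure]

lemma finite_support_of_compactSpace [CompactSpace X] (D : AlgebraicCycle X ℤ) :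
    {z | D z ≠ 0}.Finite := by
  have h (z : X) : ∃ t ∈ nhds z, (t ∩ {z | D z ≠ 0}).Finite :=
    D.supportLocallyFiniteWithinDomain z trivial
  choose t ht hfin using h
  obtain ⟨s, hs⟩ := CompactSpace.elim_nhds_subcover t ht
  refine (s.finite_toSet.biUnion fun z _ => hfin z).subset fun z hz => ?_
  obtain ⟨x, hx, hzx⟩ := Set.mem_iUnion₂.mp (hs.ge (Set.mem_univ z))
  exact Set.mem_iUnion₂.mpr ⟨x, hx, hzx, hz⟩

variable [AlgebraicGeometry.IsIntegral X] [IsLocallyNoetherian X]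

section LinearEquivalence

variable {D D' : AlgebraicCycle X ℤ} {g : X.functionField} (hg : g ≠ 0)
  (h : ∀ z, Order.coheight z = 1 → D z = D' z + Scheme.ord g z)

include hg h

lemma mul_mem_divisorSections_iff {V : X.Opens} {f : X.functionField} :
    f * g ∈ divisorSections D' V ↔ f ∈ divisorSections D V := by
  simp only [divisorSections, Set.mem_ofPred_eq, mul_eq_zero, hg, or_false]
  by_cases hf : f = 0
  · simp only [hf, true_or]
  · simp only [hf, false_or]
    refine forall₃_congr fun z _ hz => ?_
    rw [Scheme.ord_mul hf hg, h z hz, add_assoc, add_comm (D' z)]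

lemma generatesAt_mul_iff {x : X} {s : X.functionField} :
    GeneratesAt D' x (s * g) ↔ GeneratesAt D x s := by
  refine exists_congr fun U => and_congr_right fun _ => forall₂_congr fun V _ => ?_
  have key (f : X.functionField) :
      (∀ y ∈ V, ∃ r, f * g = algebraMap (X.presheaf.stalk y) X.functionField r * (s * g)) ↔
        ∀ y ∈ V, ∃ r, f = algebraMap (X.presheaf.stalk y) X.functionField r * s := by
    refine forall₂_congr fun y _ => exists_congr fun r => ?_
    rw [← mul_assoc, mul_left_inj' hg]
  constructor
  · intro H f
    rw [← mul_mem_divisorSections_iff hg h, H, key]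
  · intro H f
    rw [← div_mul_cancel₀ f hg, mul_mem_divisorSections_iff hg h, H, key]

lemma IsAmple.of_linearEquiv (hD : IsAmple D) : IsAmple D' := by
  have hn (n : ℕ) (z : X) (hz : Order.coheight z = 1) :
      (n • D) z = (n • D') z + Scheme.ord (g ^ n) z := by
    rw [Function.locallyFinsuppWithin.coe_nsmul, Function.locallyFinsuppWithin.coe_nsmul,
      Pi.smul_apply, Pi.smul_apply, h z hz, ord_pow hg, nsmul_eq_mul, nsmul_eq_mul, mul_add]
  refine ⟨hD.compactSpace, fun x => ?_, fun x => ?_⟩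
  · obtain ⟨s, hs⟩ := hD.isLineBundle x
    exact ⟨s * g, (generatesAt_mul_iff hg h).mpr hs⟩
  · obtain ⟨n, hn0, s, hs, U, hU, hx, hUs⟩ := hD.exists_affine x
    refine ⟨n, hn0, s * g ^ n, (mul_mem_divisorSections_iff (pow_ne_zero n hg) (hn n)).mpr hs,
      U, hU, hx, fun y => ?_⟩
    rw [generatesAt_mul_iff (pow_ne_zero n hg) (hn n), hUs]

end LinearEquivalence

lemma divisorSections_anti (D : AlgebraicCycle X ℤ) {V W : X.Opens} (h : V ≤ W) :
    divisorSections D W ⊆ divisorSections D V :=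
  fun _ hf => hf.imp_right fun hf z hz => hf z (h hz)

lemma GeneratesAt.of_specializes {D : AlgebraicCycle X ℤ} {x z : X} {g : X.functionField}
    (hg : GeneratesAt D x g) (h : z ⤳ x) : GeneratesAt D z g :=
  hg.imp fun U hU => ⟨h.mem_open U.isOpen hU.1, hU.2⟩

lemma GeneratesAt.mem_divisorSections {D : AlgebraicCycle X ℤ} {x : X} {g : X.functionField}
    (hg : GeneratesAt D x g) : ∃ U : X.Opens, x ∈ U ∧ g ∈ divisorSections D U := by
  obtain ⟨U, hxU, hU⟩ := hg
  exact ⟨U, hxU, (hU U le_rfl g).mpr fun _ _ => ⟨1, by rw [map_one, one_mul]⟩⟩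

/-- Rational functions on `X` without poles along the prime divisors through a point are regular
there. (For Noetherian `X` this is normality, phrased in terms of orders of vanishing.) -/
def RegularInCodimOne (X : Scheme.{u}) [AlgebraicGeometry.IsIntegral X] [IsLocallyNoetherian X] :
    Prop :=
  ∀ (x : X) (f : X.functionField),
    (∀ z, Order.coheight z = 1 → z ⤳ x → 0 ≤ Scheme.ord f z) → f ∈ regularAt x

lemma RegularInCodimOne.exists_ord_eq_one (hX : RegularInCodimOne X) {z : X}
    (hz : Order.coheight z = 1) :
    ∃ f, Scheme.ord f z = 1 := by
  have hfield : ¬ IsField (X.presheaf.stalk z) := fun h => by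
    have := ringKrullDim_stalk_eq_coheight z
    rw [ringKrullDim_eq_zero_of_isField h, hz] at this
    exact absurd this (by norm_cast)
  obtain ⟨r, hr, hr'⟩ := Ring.exists_not_isUnit_of_not_isField hfield
  obtain ⟨f, ⟨hf, hf'⟩, hmin⟩ := exists_minimalFor_of_wellFoundedLT
    (fun f => f ∈ regularAt z ∧ f⁻¹ ∉ regularAt z) (fun f => (Scheme.ord f z).toNat)
    ⟨_, ⟨r, rfl⟩, mt (inv_algebraMap_mem_regularAt_iff hr).mp hr'⟩
  refine ⟨f, ord_eq_one_of_forall_div_mem_regularAt hz hf hf' fun s hs hs' => ?_⟩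
  refine hX z _ fun w hw hwz => ?_
  rw [eq_of_specializes_of_coheight_eq_one hwz hw hz,
    ord_div (ne_zero_of_inv_notMem_regularAt hs') (ne_zero_of_inv_notMem_regularAt hf')]
  have hle : (Scheme.ord f z).toNat ≤ (Scheme.ord s z).toNat :=
    (le_total _ _).elim (hmin ⟨hs, hs'⟩) id
  have := ord_pos_of_inv_notMem_regularAt hz hs hs'
  omega

variable [CompactSpace X]

variable {D : AlgebraicCycle X ℤ} {x z : X} {f g : X.functionField}

lemma finite_ord_add_ne_zero (D : AlgebraicCycle X ℤ) (f : X.functionField) :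
    {z | Scheme.ord f z + D z ≠ 0}.Finite := by
  refine ((finite_ord_ne_zero f).union (finite_support_of_compactSpace D)).subset fun z hz => ?_
  by_contra! h
  simp only [Set.mem_union, Set.mem_ofPred_eq, not_or, not_not] at h
  exact hz (by rw [h.1, h.2, add_zero])

lemma exists_opens_forall_ord_add {P : ℤ → Prop} (h0 : P 0)
    (h : ∀ z, Order.coheight z = 1 → z ⤳ x → P (Scheme.ord f z + D z)) :
    ∃ V : X.Opens, x ∈ V ∧ ∀ z ∈ V, Order.coheight z = 1 → P (Scheme.ord f z + D z) := by
  obtain ⟨V, hV⟩ := exists_opens_mem_iff_forall_not_specializes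
    (S := {z | Order.coheight z = 1 ∧ ¬ P (Scheme.ord f z + D z)})
    ((finite_ord_add_ne_zero D f).subset fun z hz hz0 => hz.2 (hz0 ▸ h0))
  refine ⟨V, (hV x).mpr fun z hz hzx => hz.2 (h z hz.1 hzx), fun z hz hz1 => ?_⟩
  by_contra hneg
  exact (hV z).mp hz z ⟨hz1, hneg⟩ specializes_rfl

lemma GeneratesAt.ne_zero (hg : GeneratesAt D x g) : g ≠ 0 := by
  rintro rfl
  obtain ⟨U, hxU, hU⟩ := hg
  -- No prime divisor passes through the generic point, so `1` is a section of `O_X(D)` there.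
  obtain ⟨V, hηV, hV⟩ := exists_opens_forall_ord_add (D := D) (f := 1) (x := genericPoint X)
    (P := (0 ≤ ·)) le_rfl fun z hz hzη => by
      have hmax : IsMax z := fun y _ => Scheme.le_iff_specializes.mpr
        (hzη.trans (genericPoint_specializes y))
      rw [Order.coheight_eq_zero.mpr hmax] at hz
      exact absurd hz zero_ne_one
  have hηU : genericPoint X ∈ U := (genericPoint_specializes x).mem_open U.isOpen hxU
  obtain ⟨r, hr⟩ := (hU (U ⊓ V) inf_le_left 1).mp
    (divisorSections_anti D inf_le_right (Or.inr hV)) _ ⟨hηU, hηV⟩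
  rw [mul_zero] at hr
  exact one_ne_zero hr

lemma GeneratesAt.div_mem_regularAt (hg : GeneratesAt D x g)
    (hf : ∀ z, Order.coheight z = 1 → z ⤳ x → 0 ≤ Scheme.ord f z + D z) : f / g ∈ regularAt x := by
  obtain ⟨V, hxV, hV⟩ := exists_opens_forall_ord_add (P := (0 ≤ ·)) le_rfl hf
  have hg0 := hg.ne_zero
  obtain ⟨U, hxU, hU⟩ := hg
  obtain ⟨r, hr⟩ := (hU (U ⊓ V) inf_le_left f).mp
    (divisorSections_anti D inf_le_right (Or.inr hV)) x ⟨hxU, hxV⟩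
  exact ⟨r, by rw [hr, mul_div_cancel_right₀ _ hg0]⟩

lemma GeneratesAt.ord_add_nonneg (hg : GeneratesAt D x g) (hz : Order.coheight z = 1)
    (hzx : z ⤳ x) : 0 ≤ Scheme.ord g z + D z := by
  obtain ⟨U, hxU, hgU⟩ := hg.mem_divisorSections
  exact hgU.resolve_left hg.ne_zero z (hzx.mem_open U.isOpen hxU) hz

lemma regularInCodimOne_of_generatesAt (hD : ∀ x, ∃ g, GeneratesAt D x g) :
    RegularInCodimOne X := by
  intro x f hf
  by_cases hf0 : f = 0
  · rw [hf0]
    exact zero_mem _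
  obtain ⟨g, hg⟩ := hD x
  rw [← mul_div_cancel_right₀ f hg.ne_zero]
  refine hg.div_mem_regularAt fun z hz hzx => ?_
  rw [Scheme.ord_mul hf0 hg.ne_zero, add_assoc]
  exact add_nonneg (hf z hz hzx) (hg.ord_add_nonneg hz hzx)

lemma RegularInCodimOne.generatesAt (hX : RegularInCodimOne X) (hf : f ≠ 0)
    (h : ∀ z, Order.coheight z = 1 → z ⤳ x → Scheme.ord f z + D z = 0) : GeneratesAt D x f := by
  obtain ⟨U, hxU, hU⟩ := exists_opens_forall_ord_add (P := (· = 0)) rfl h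
  refine ⟨U, hxU, fun V hV s => ?_⟩
  by_cases hs : s = 0
  · exact iff_of_true (Or.inl hs) fun y _ => ⟨0, by rw [map_zero, zero_mul, hs]⟩
  have hord {z : X} (hz : z ∈ V) (hz1 : Order.coheight z = 1) :
      Scheme.ord (s / f) z = Scheme.ord s z + D z := by
    have := hU z (hV hz) hz1
    rw [ord_div hs hf]
    omega
  have hdiv {y : X} : (∃ r, s = algebraMap (X.presheaf.stalk y) X.functionField r * f) ↔
      s / f ∈ regularAt y :=
    exists_congr fun r => by rw [eq_comm, ← eq_div_iff hf]
  simp only [hdiv]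
  constructor
  · exact fun hsV y hy => hX y _ fun z hz hzy =>
      (hord (hzy.mem_open V.isOpen hy) hz).ge.trans' <|
        hsV.resolve_left hs z (hzy.mem_open V.isOpen hy) hz
  · exact fun hreg => Or.inr fun z hz hz1 =>
      (ord_nonneg_of_mem_regularAt (hreg z hz)).trans_eq (hord hz hz1)

lemma GeneratesAt.ord_add_eq_zero (hX : RegularInCodimOne X) (hg : GeneratesAt D x g)
    (hz : Order.coheight z = 1) (hzx : z ⤳ x) : Scheme.ord g z + D z = 0 := by
  refine le_antisymm (not_lt.mp fun hpos => ?_) (hg.ord_add_nonneg hz hzx)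
  obtain ⟨f, hf⟩ := hX.exists_ord_eq_one hz
  have hf0 : f ≠ 0 := by
    rintro rfl
    rw [Scheme.ord_zero] at hf
    exact zero_ne_one hf
  -- If `g` vanished to excess along `z`, then `g / f` would be a section not divisible by `g`.
  have hmem := (hg.of_specializes hzx).div_mem_regularAt (f := g / f) fun w hw hwz => by
    rw [eq_of_specializes_of_coheight_eq_one hwz hw hz, ord_div hg.ne_zero hf0, hf]
    omega
  rw [div_right_comm, div_self hg.ne_zero, one_div] at hmem
  have := ord_nonneg_of_mem_regularAt hmem
  rw [ord_inv, hf] at this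
  omega

end WeilDivisors

section Ample

variable {X : Scheme.{u}} [AlgebraicGeometry.IsIntegral X]

lemma exists_nat_forall_neg_le {α : Type*} {F : α → ℤ} (hF : {z | F z ≠ 0}.Finite) :
    ∃ n : ℕ, ∀ z, -F z ≤ n := by
  obtain ⟨m, hm⟩ := (hF.image (-F ·)).bddAbove
  refine ⟨m.toNat, fun z => ?_⟩
  by_cases hz : F z = 0
  · rw [hz, neg_zero]
    exact Int.natCast_nonneg _
  · exact (hm ⟨z, hz, rfl⟩).trans (Int.self_le_toNat m)

variable [IsLocallyNoetherian X] {D : AlgebraicCycle X ℤ} {x : X}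

lemma exists_ord_pos_of_not_specializes {U : X.Opens} (hU : IsAffineOpen U) (hx : x ∈ U)
    {Z : Set X} (hZ : Z.Finite) (hZx : ∀ z ∈ Z, ¬ z ⤳ x) :
    ∃ h : X.functionField, h ≠ 0 ∧ (∀ z ∈ U, 0 ≤ Scheme.ord h z) ∧
      (∀ z, z ⤳ x → Scheme.ord h z = 0) ∧
      ∀ z ∈ Z, z ∈ U → Order.coheight z = 1 → 0 < Scheme.ord h z := by
  have : Nonempty U := ⟨⟨x, hx⟩⟩
  obtain ⟨W, hW⟩ := exists_opens_mem_iff_forall_not_specializes hZ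
  obtain ⟨h, hhW, hhx⟩ := hU.exists_basicOpen_le ⟨x, (hW x).mpr hZx⟩ hx
  have h0 : h ≠ 0 := by
    rintro rfl
    rw [Scheme.basicOpen_zero] at hhx
    exact hhx
  have hreg {z : X} (hz : z ∈ U) := germToFunctionField_mem_regularAt hz h
  refine ⟨X.germToFunctionField U h, germToFunctionField_ne_zero h0,
    fun z hz => ord_nonneg_of_mem_regularAt (hreg hz), fun z hzx => ?_, fun z hz hzU hz1 => ?_⟩
  · have hzU := hzx.mem_open U.isOpen hx
    exact ord_eq_zero_of_mem_regularAt_of_inv_mem (hreg hzU)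
      ((inv_germToFunctionField_mem_regularAt_iff hzU h0).mpr
        (hzx.mem_open (X.basicOpen h).isOpen hhx))
  · refine ord_pos_of_inv_notMem_regularAt hz1 (hreg hzU) fun hinv => ?_
    exact (hW z).mp (hhW ((inv_germToFunctionField_mem_regularAt_iff hzU h0).mp hinv)) z hz
      specializes_rfl

lemma exists_mem_divisorSections_forall_ord_add_eq_zero [CompactSpace X] {U : X.Opens}
    (hU : IsAffineOpen U) (hx : x ∈ U) {g : X.functionField} (hg : g ≠ 0)
    (hgx : ∀ z, Order.coheight z = 1 → z ⤳ x → Scheme.ord g z + D z = 0) :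
    ∃ s ≠ 0, s ∈ divisorSections D U ∧
      ∀ z, Order.coheight z = 1 → z ⤳ x → Scheme.ord s z + D z = 0 := by
  have hfin := finite_ord_add_ne_zero D g
  obtain ⟨h, h0, hnonneg, hzero, hpos⟩ := exists_ord_pos_of_not_specializes hU hx
    (Z := {z | Order.coheight z = 1 ∧ Scheme.ord g z + D z ≠ 0})
    (hfin.subset fun z hz => hz.2) fun z hz hzx => hz.2 (hgx z hz.1 hzx)
  obtain ⟨n, hn⟩ := exists_nat_forall_neg_le hfin
  have hord (z : X) :
      Scheme.ord (h ^ n * g) z + D z = n * Scheme.ord h z + (Scheme.ord g z + D z) := by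
    rw [Scheme.ord_mul (pow_ne_zero n h0) hg, ord_pow h0, add_assoc]
  refine ⟨h ^ n * g, mul_ne_zero (pow_ne_zero n h0) hg, Or.inr fun z hz hz1 => ?_,
    fun z hz1 hzx => ?_⟩
  · rw [hord]
    by_cases hgz : Scheme.ord g z + D z = 0
    · rw [hgz, add_zero]
      exact mul_nonneg (Int.natCast_nonneg n) (hnonneg z hz)
    · have := le_mul_of_one_le_right (Int.natCast_nonneg n) (hpos z ⟨hz1, hgz⟩ hz hz1)
      have := hn z
      omega
  · rw [hord, hgx z hz1 hzx, hzero z hzx, mul_zero, add_zero]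

namespace IsAmple

lemma regularInCodimOne (hD : IsAmple D) : RegularInCodimOne X :=
  have := hD.compactSpace
  regularInCodimOne_of_generatesAt hD.isLineBundle

lemma exists_isAffineOpen_mem_iff_ord_add_eq_zero (hD : IsAmple D) (x : X) :
    ∃ n, 0 < n ∧ ∃ s ≠ 0, ∃ U : X.Opens, IsAffineOpen U ∧ x ∈ U ∧ ∀ z, Order.coheight z = 1 →
      0 ≤ Scheme.ord s z + (n • D) z ∧ (z ∈ U ↔ Scheme.ord s z + (n • D) z = 0) := by
  have := hD.compactSpace
  have hX := hD.regularInCodimOne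
  obtain ⟨n, hn, s, hs, U, hU, hx, hUs⟩ := hD.exists_affine x
  have hs0 := ((hUs x).mp hx).ne_zero
  refine ⟨n, hn, s, hs0, U, hU, hx, fun z hz => ⟨hs.resolve_left hs0 z trivial hz, ?_⟩⟩
  rw [hUs]
  refine ⟨fun h => h.ord_add_eq_zero hX hz specializes_rfl, fun h => ?_⟩
  refine hX.generatesAt hs0 fun w hw hwz => ?_
  rwa [eq_of_specializes_of_coheight_eq_one hwz hw hz]

lemma exists_section_ord_add_pos (hD : IsAmple D) (x : X) {Z : Set X} (hZ : Z.Finite)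
    (hZx : ∀ z ∈ Z, ¬ z ⤳ x) :
    ∃ n, 0 < n ∧ ∃ s ≠ 0, s ∈ divisorSections (n • D) ⊤ ∧
      (∀ z, Order.coheight z = 1 → z ⤳ x → Scheme.ord s z + (n • D) z = 0) ∧
      ∀ z ∈ Z, Order.coheight z = 1 → 0 < Scheme.ord s z + (n • D) z := by
  have := hD.compactSpace
  obtain ⟨n, hn, s, hs0, U, hU, hxU, hs⟩ := hD.exists_isAffineOpen_mem_iff_ord_add_eq_zero x
  obtain ⟨h, h0, hnonneg, hzero, hpos⟩ := exists_ord_pos_of_not_specializes hU hxU hZ hZx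
  obtain ⟨j, hj⟩ := exists_nat_forall_neg_le (finite_ord_ne_zero h)
  -- `h` may have poles outside `U`; there `s` vanishes, and a high power of `s` cancels them.
  have hord (z : X) : Scheme.ord (h * s ^ (j + 1)) z + (((j + 1) * n) • D) z =
      Scheme.ord h z + (j + 1) * (Scheme.ord s z + (n • D) z) := by
    rw [Scheme.ord_mul h0 (pow_ne_zero _ hs0), ord_pow hs0, mul_smul,
      Function.locallyFinsuppWithin.coe_nsmul, Pi.smul_apply, nsmul_eq_mul, Nat.cast_add_one]
    ring
  have hin {z : X} (hz : Order.coheight z = 1) (hzU : z ∈ U) :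
      Scheme.ord (h * s ^ (j + 1)) z + (((j + 1) * n) • D) z = Scheme.ord h z := by
    rw [hord, (hs z hz).2.mp hzU, mul_zero, add_zero]
  have hout {z : X} (hz : Order.coheight z = 1) (hzU : z ∉ U) :
      0 < Scheme.ord (h * s ^ (j + 1)) z + (((j + 1) * n) • D) z := by
    rw [hord]
    have h1 := (hs z hz).1.lt_of_ne' (mt (hs z hz).2.mpr hzU)
    have h2 := le_mul_of_one_le_right (show 0 ≤ (j + 1 : ℤ) by omega) h1
    have := hj z
    omega
  refine ⟨(j + 1) * n, Nat.mul_pos j.succ_pos hn, h * s ^ (j + 1),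
    mul_ne_zero h0 (pow_ne_zero _ hs0), Or.inr fun z _ hz => ?_, fun z hz hzx => ?_,
    fun z hzZ hz => ?_⟩
  · by_cases hzU : z ∈ U
    · exact (hnonneg z hzU).trans_eq (hin hz hzU).symm
    · exact (hout hz hzU).le
  · exact (hin hz (hzx.mem_open U.isOpen hxU)).trans (hzero z hzx)
  · by_cases hzU : z ∈ U
    · exact (hpos z hzZ hzU hz).trans_eq (hin hz hzU).symm
    · exact hout hz hzU

end IsAmple

end Ample

section ToricSections

variable {k : Type u} [Field k] {N : Type u} [AddCommGroup N] [Module.Free ℤ N]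
  [Module.Finite ℤ N] {Δ : Fan N} {a : Δ.Ray → ℤ}

lemma nsmul_toricDivisor (a : Δ.Ray → ℤ) (n : ℕ) :
    n • toricDivisor k Δ a = toricDivisor k Δ (n • a) := by
  classical
  refine DFunLike.ext _ _ fun z => ?_
  rw [Function.locallyFinsuppWithin.coe_nsmul, Pi.smul_apply, toricDivisor_apply,
    toricDivisor_apply, Finset.smul_sum]
  exact Finset.sum_congr rfl fun v _ => by rw [smul_ite, smul_zero, Pi.smul_apply]

lemma character_mem_divisorSections {u : Module.Dual ℤ N} (hu : u ∈ Δ.polytope a) :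
    character k Δ u ∈ divisorSections (toricDivisor k Δ a) ⊤ := by
  refine Or.inr fun z _ hz => ?_
  rcases mem_torus_or_exists_eq_divisorPoint hz with h | ⟨v, rfl⟩
  · rw [ord_character_of_mem_torus h, toricDivisor_of_mem_torus a h, add_zero]
  · rw [ord_character, toricDivisor_divisorPoint]
    exact hu v

lemma mem_polytope_of_mem_divisorSections {p : ChartRing k Δ.zeroCone.1}
    (hp : chartToFunctionField k Δ Δ.zeroCone p ∈ divisorSections (toricDivisor k Δ a) ⊤)
    {u : dualMonoid Δ.zeroCone.1} (hu : u ∈ p.coeff.support) : u.1 ∈ Δ.polytope a := by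
  intro v
  have hp0 : p ≠ 0 := by
    rintro rfl
    exact Finset.notMem_empty _ hu
  have h := hp.resolve_left (chartToFunctionField_ne_zero hp0) _ trivial (coheight_divisorPoint v)
  rw [toricDivisor_divisorPoint] at h
  have := le_of_le_ord_divisorPoint le_rfl hu (v := v)
  omega

lemma exists_laurent_of_mem_divisorSections (hX : RegularInCodimOne (toricVariety k Δ))
    {V : (toricVariety k Δ).Opens} (hV : chartOpen k Δ Δ.zeroCone ≤ V)
    {f : (toricVariety k Δ).functionField} (hf : f ∈ divisorSections (toricDivisor k Δ a) V) :
    ∃ p, chartToFunctionField k Δ Δ.zeroCone p = f := by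
  rcases hf with rfl | hf
  · exact ⟨0, map_zero _⟩
  refine exists_chartToFunctionField_eq fun y hy => hX y f fun z hz hzy => ?_
  have hzT := hzy.mem_open (chartOpen k Δ Δ.zeroCone).isOpen hy
  have h := hf z (hV hzT) hz
  rwa [toricDivisor_of_mem_torus a hzT, add_zero] at h

variable {σ : Δ.Cone} {x : toricVariety k Δ}

lemma exists_exponent_of_forall_ord_add_eq_zero (hX : RegularInCodimOne (toricVariety k Δ))
    (hx : ∀ v : Δ.Ray, divisorPoint k Δ v ⤳ x ↔ latticeVec v.1 ∈ σ.1)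
    {p : ChartRing k Δ.zeroCone.1} (hp0 : chartToFunctionField k Δ Δ.zeroCone p ≠ 0)
    (hp : ∀ z, Order.coheight z = 1 → z ⤳ x →
      Scheme.ord (chartToFunctionField k Δ Δ.zeroCone p) z + toricDivisor k Δ a z = 0) :
    ∃ u ∈ p.coeff.support, ∀ v : Δ.Ray, latticeVec v.1 ∈ σ.1 → u.1 v.1 + a v = 0 := by
  let ι := chartToFunctionField k Δ Δ.zeroCone
  let t (u : dualMonoid Δ.zeroCone.1) := ι (.single u (p.coeff u))
  have ht {u} (hu : u ∈ p.coeff.support) : t u ≠ 0 :=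
    chartToFunctionField_ne_zero
      (AddMonoidAlgebra.single_ne_zero.mpr (Finsupp.mem_support_iff.mp hu))
  have hsum : ∑ u ∈ p.coeff.support, t u / ι p = 1 := by
    rw [← Finset.sum_div, ← map_sum, div_eq_one_iff_eq hp0]
    exact congrArg ι (AddMonoidAlgebra.sum_coeff_single p)
  have hreg : ∀ u ∈ p.coeff.support, t u / ι p ∈ regularAt x := by
    refine fun u hu => hX x _ fun z hz hzx => ?_
    rw [ord_div (ht hu) hp0]
    rcases mem_torus_or_exists_eq_divisorPoint hz with hzT | ⟨v, rfl⟩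
    · have hpz := hp z hz hzx
      rw [toricDivisor_of_mem_torus a hzT, add_zero] at hpz
      rw [hpz, sub_zero]
      exact ord_nonneg_of_mem_regularAt (chartToFunctionField_mem_regularAt hzT _)
    · rw [ord_single_divisorPoint v u (Finsupp.mem_support_iff.mp hu), sub_nonneg]
      exact le_of_le_ord_divisorPoint le_rfl hu
  -- In the local ring at `x`, one of the summands `t u / p` of `1` must be a unit.
  obtain ⟨u, hu, -, hinv⟩ := exists_inv_mem_regularAt_of_sum hreg (hsum ▸ one_ne_zero)
    (by rw [hsum, inv_one]; exact one_mem _)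
  refine ⟨u, hu, fun v hv => ?_⟩
  have hvx := (hx v).mpr hv
  have hord := ord_eq_zero_of_mem_regularAt_of_inv_mem (regularAt_le_of_specializes hvx (hreg u hu))
    (regularAt_le_of_specializes hvx hinv)
  have hpv := hp _ (coheight_divisorPoint v) hvx
  rw [ord_div (ht hu) hp0, ord_single_divisorPoint v u (Finsupp.mem_support_iff.mp hu)] at hord
  rw [toricDivisor_divisorPoint] at hpv
  omega

namespace IsAmple

lemma exists_integral (ha : IsAmple (toricDivisor k Δ a)) (σ : Δ.Cone) :
    ∃ u : Module.Dual ℤ N, ∀ v : Δ.Ray, latticeVec v.1 ∈ σ.1 → u v.1 + a v = 0 := by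
  have := ha.compactSpace
  have hX := ha.regularInCodimOne
  obtain ⟨x, hxσ, hx⟩ := exists_point_forall_divisorPoint_specializes_iff k σ
  obtain ⟨g, hg⟩ := ha.isLineBundle x
  obtain ⟨s, hs0, hs, hsx⟩ := exists_mem_divisorSections_forall_ord_add_eq_zero
    (chartOpen_isAffineOpen k Δ σ) hxσ hg.ne_zero fun _ => hg.ord_add_eq_zero hX
  obtain ⟨p, rfl⟩ := exists_laurent_of_mem_divisorSections hX (chartOpen_mono (Δ.zeroCone_le σ)) hs
  obtain ⟨u, -, hu⟩ := exists_exponent_of_forall_ord_add_eq_zero hX hx hs0 hsx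
  exact ⟨u.1, hu⟩

lemma exists_strict (ha : IsAmple (toricDivisor k Δ a)) (σ : Δ.Cone) :
    ∃ n, 0 < n ∧ ∃ u ∈ Δ.polytope (n • a),
      ∀ v, u v.1 + (n • a) v = 0 ↔ latticeVec v.1 ∈ σ.1 := by
  have hX := ha.regularInCodimOne
  obtain ⟨x, -, hx⟩ := exists_point_forall_divisorPoint_specializes_iff k σ
  obtain ⟨n, hn, s, hs0, hs, hsx, hpos⟩ := ha.exists_section_ord_add_pos x
    (Z := divisorPoint k Δ '' {v | latticeVec v.1 ∉ σ.1}) (Set.toFinite _) (by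
      rintro _ ⟨v, hv, rfl⟩
      exact mt (hx v).mp hv)
  rw [nsmul_toricDivisor] at hs hsx hpos
  obtain ⟨p, rfl⟩ := exists_laurent_of_mem_divisorSections hX le_top hs
  obtain ⟨u, hu, hu0⟩ := exists_exponent_of_forall_ord_add_eq_zero hX hx hs0 hsx
  refine ⟨n, hn, u.1, mem_polytope_of_mem_divisorSections hs hu, fun v => ⟨fun h => ?_, hu0 v⟩⟩
  by_contra hv
  have hvpos := hpos _ ⟨v, hv, rfl⟩ (coheight_divisorPoint v)
  rw [toricDivisor_divisorPoint] at hvpos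
  have := le_of_le_ord_divisorPoint le_rfl hu (v := v)
  omega

lemma isStrictlyConvex (ha : IsAmple (toricDivisor k Δ a)) : Δ.IsStrictlyConvex a :=
  ⟨ha.exists_integral, ha.exists_strict⟩

end IsAmple

end ToricSections

end Toric

theorem mainTheorem4_general {k N : Type u} [Field k] [AddCommGroup N] [Module.Free ℤ N]
    [Module.Finite ℤ N] (Δ : Toric.Fan N)
    [AlgebraicGeometry.UniversallyClosed (Toric.toricVarietyToSpec k Δ)]
    (D : AlgebraicGeometry.AlgebraicCycle (Toric.toricVariety k Δ) ℤ) (hD : Toric.IsAmple D)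
    (a : Δ.Ray → ℤ) (g : (Toric.toricVariety k Δ).functionField) (hg : g ≠ 0)
    (hDa : ∀ z : Toric.toricVariety k Δ, Order.coheight z = 1 →
      D z = Toric.toricDivisor k Δ a z + AlgebraicGeometry.Scheme.ord g z) :
    Toric.irrelevantIdeal k Δ = (Toric.sectionIdeal k Δ D a g).radical := by
  have hΔ := Toric.Fan.isComplete_of_universallyClosed k Δ
  have ha := (hD.of_linearEquiv hg hDa).isStrictlyConvex
  refine le_antisymm (ha.irrelevantIdeal_le_radical hΔ fun u hu => ?_)
    ((Toric.isRadical_irrelevantIdeal).radical_le_iff.mpr (Ideal.span_le.mpr ?_))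
  · refine Ideal.subset_span ⟨Toric.character k Δ u / g, ?_, _, ?_, rfl⟩
    · rw [← Toric.mul_mem_divisorSections_iff hg hDa, div_mul_cancel₀ _ hg]
      exact Toric.character_mem_divisorSections hu
    · rw [div_mul_cancel₀ _ hg, Toric.chartToFunctionField_single]
  · rintro _ ⟨f, hf, p, hp, rfl⟩
    rw [← Toric.mul_mem_divisorSections_iff hg hDa, ← hp] at hf
    exact ha.homogenize_mem_irrelevantIdeal hΔ fun u hu =>
      Toric.mem_polytope_of_mem_divisorSections hf hu

theorem mainTheorem4 {k N : Type u} [Field k] [IsAlgClosed k] [AddCommGroup N] [Module.Free ℤ N]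
    [Module.Finite ℤ N] (Δ : Toric.Fan N)
    (hX : AlgebraicGeometry.IsProper (Toric.toricVarietyToSpec k Δ))
    (D : AlgebraicGeometry.AlgebraicCycle (Toric.toricVariety k Δ) ℤ) (hD : Toric.IsAmple D)
    (a : Δ.Ray → ℤ) (g : (Toric.toricVariety k Δ).functionField) (hg : g ≠ 0)
    (hDa : ∀ z : Toric.toricVariety k Δ, Order.coheight z = 1 →
      D z = Toric.toricDivisor k Δ a z + AlgebraicGeometry.Scheme.ord g z) :
    Toric.irrelevantIdeal k Δ = (Toric.sectionIdeal k Δ D a g).radical :=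
  mainTheorem4_general Δ D hD a g hg hDa
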